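/- Let $V:\mathbf R^n\to\mathbf R$ be smooth and bounded above. For $\varepsilon>0$ put $L_\varepsilon(x,v)=\tfrac12|v|^2-\varepsilon V(x)$ and $$c_\varepsilon(x,y)=\inf\int_0^1 L_\varepsilon(\gamma(t),\dot\gamma(t))\,dt ,$$ the infimum being over smooth curves $\gamma:[0,1]\to\mathbf R^n$ with $\gamma(0)=x$, $\gamma(1)=y$. Identify tangent and cotangent vectors by the Euclidean metric, let $H_\varepsilon(x,p)=\tfrac12|p|^2+\varepsilon V(x)$, and let $\Phi^\varepsilon_t(x,p)$ be the position at time $t$ of the solution of $\dot q=p,\ \dot p=-\varepsilon\nabla V(q)$ that starts at $(x,p)$. Call $(x,p)$ *regular* if this solution exists on $[0,1]$ and $t\in[0,1]\mapsto\Phi^\varepsilon_t(x,p)$ is the unique path of least action between its endpoints, and *conjugate* if $\Phi^\varepsilon_1(x,\cdot)$ does not have full rank at $p$. For each $\varepsilon>0$ let $\mathcal U_\varepsilon\subset T\mathbf R^n=\mathbf R^n\times\mathbf R^n$ be an open set all of whose elements are regular and not conjugate. For a cost $c$ and an open set $\mathcal O\subset\mathbf R^n\times\mathbf R^n$ let $\mathcal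 O_x=\{y:(x,y)\in\mathcal O\}$. The conditions (A0)–(A2) on $\mathcal O$ are: $c$ is $C^4$ on $\mathcal O$; $y\mapsto d_xc(x,y)$ is injective on $\mathcal O_x$ for each $x$; $v\mapsto d_xd_yc(x,y)(v)$ is injective for each $(x,y)\in\mathcal O$. When they hold, put $\mathcal K_x=\{-d_xc(x,y): y\in\mathcal O_x\}$ and $\exp^c(x,\alpha)=[d_xc(x,\cdot)|_{\mathcal O_x}]^{-1}(-\alpha)$ for $\alpha\in\mathcal K_x$. For a point $x$, a vector $u$, $\alpha\in\mathcal K_x$ and a covector $\alpha_1$ the cross-curvature is $$\mathcal C_x(u,\alpha,\alpha_1)=-\tfrac32\,\partial_s^2\partial_t^2\,c\big(\gamma(t),\exp^c(x,\alpha+s\alpha_1)\big)\Big|_{t=s=0},$$ where $\gamma$ is any smooth curve with $\gamma(0)=x$, $\dot\gamma(0)=u$. The cost is *positively cross-curved* (B3s) on $\mathcal O$ if always $\mathcal C_x(u,\alpha,\alpha_1)\ge0$, with equality only if $u=0$ or $\alpha_1=0$; it satisfies (A3s) on $\mathcal O$ if the same holds for all $u,\alpha,\alpha_1$ with $\alpha_1(u)=0$.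 **Theorem.** Let $\mathcal U\subset T\mathbf R^n$ be bounded and open, let $C>0$, and suppose that $$\int_0^1\int_0^\tau\big\langle u,(1-t)\,\partial_s^2\,\mathrm{Hess}\,V_{x+t(v+sw)}\,u\big\rangle\Big|_{s=0}\,dt\,d\tau\ \ge\ C\qquad(*)$$ for all $(x,v)\in\mathcal U$ and all unit vectors $u,w$. Let $\mathcal K_\varepsilon=\{(x,\Phi^\varepsilon_1(x,\alpha)):(x,\alpha)\in\mathcal U_\varepsilon\cap\mathcal U\}$. Then for all small enough $\varepsilon>0$ the set $\mathcal K_\varepsilon$ is open, and on it $c_\varepsilon$ satisfies (A0)–(A2) and is positively cross-curved (B3s). If $(*)$ is assumed only for orthogonal unit vectors $u,w$, then for all small enough $\varepsilon>0$ the set $\mathcal K_\varepsilon$ is open and on it $c_\varepsilon$ satisfies (A0)–(A2) and (A3s). -/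

import Mathlib

open Set
open scoped ContDiff InnerProductSpace

noncomputable section

namespace MTW

/-! ### Least action costs, for a Lagrangian `L x v` on the tangent bundle of `E` -/

section Action

variable {E : Type*} [NormedAddCommGroup E] [InnerProductSpace ℝ E]

/-- `γ` is a smooth curve, parametrised by `[0,1]`, from `x` to `y`. -/
def IsSmoothCurve (γ : ℝ → E) (x y : E) : Prop :=
  ContDiffOn ℝ ∞ γ (Icc 0 1) ∧ γ 0 = x ∧ γ 1 = y

/-- The action `∫₀¹ L(γ(t), γ'(t)) dt`. -/
def action (L : E → E → ℝ) (γ : ℝ → E) : ℝ :=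
  ∫ t in (0 : ℝ)..1, L (γ t) (derivWithin γ (Icc 0 1) t)

/-- The cost `c(x,y)`: the infimum of the action over smooth curves from `x` to `y`. -/
def actionCost (L : E → E → ℝ) (x y : E) : ℝ :=
  sInf {a : ℝ | ∃ γ : ℝ → E, IsSmoothCurve γ x y ∧ a = action L γ}

/-- `γ` is a path of least action from `x` to `y`. -/
def IsLeastActionPath (L : E → E → ℝ) (γ : ℝ → E) (x y : E) : Prop :=
  IsSmoothCurve γ x y ∧ ∀ η : ℝ → E, IsSmoothCurve η x y → action L γ ≤ action L η

end Action

/-! ### Hamiltonian flows, with cotangent vectors identified with tangent vectors -/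

section Hamiltonian

variable {E : Type*} [NormedAddCommGroup E] [InnerProductSpace ℝ E] [CompleteSpace E]

/-- The Hamiltonian vector field `(∂H/∂p, -∂H/∂q)`. -/
def hamiltonianField (H : E × E → ℝ) (z : E × E) : E × E :=
  (gradient (fun p => H (z.1, p)) z.2, -gradient (fun q => H (q, z.2)) z.1)

/-- `z` is an integral curve of the Hamiltonian vector field with `z 0 = z₀`, on the time
interval between `0` and `T`. -/
def IsHamiltonianCurve (H : E × E → ℝ) (z₀ : E × E) (T : ℝ) (z : ℝ → E × E) : Prop :=
  z 0 = z₀ ∧ ∀ t ∈ uIcc 0 T, HasDerivWithinAt z (hamiltonianField H (z t)) (uIcc 0 T) t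

open Classical in
/-- The Hamiltonian flow at time `t`: the value at time `t` of the integral curve that starts at
`z₀`. It has the dummy value `z₀` where the integral curve does not live until time `t`. -/
def hamiltonianFlow (H : E × E → ℝ) (t : ℝ) (z₀ : E × E) : E × E :=
  if h : ∃ z : ℝ → E × E, IsHamiltonianCurve H z₀ t z then h.choose t else z₀

/-- `Φ_t(x,α)`: the projection to the base of the Hamiltonian flow. -/
def flowProj (H : E × E → ℝ) (t : ℝ) (z₀ : E × E) : E :=
  (hamiltonianFlow H t z₀).1

/-- `(x,α)` is regular: its Hamiltonian trajectory exists on `[0,1]`, and `t ↦ Φ_t(x,α)` is the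
unique path of least action between its endpoints. -/
def IsRegularCovector (L : E → E → ℝ) (H : E × E → ℝ) (z₀ : E × E) : Prop :=
  (∃ z : ℝ → E × E, IsHamiltonianCurve H z₀ 1 z) ∧
  IsLeastActionPath L (fun t => flowProj H t z₀) z₀.1 (flowProj H 1 z₀) ∧
  ∀ η : ℝ → E, IsLeastActionPath L η z₀.1 (flowProj H 1 z₀) →
    EqOn η (fun t => flowProj H t z₀) (Icc 0 1)

/-- `(x,α)` is in the conjugate locus: `Φ_1(x,·)` does not have full rank at `α`. -/
def IsConjugate (H : E × E → ℝ) (z₀ : E × E) : Prop :=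
  ¬ Function.Surjective (fderiv ℝ (fun β : E => flowProj H 1 (z₀.1, β)) z₀.2)

end Hamiltonian

/-! ### Cross-curvature of a cost on a set `O` of pairs of points

For `O = M × N` the slice of `O` over `x ∈ M` is `N`. -/

section Cost

variable {E : Type*} [NormedAddCommGroup E] [NormedSpace ℝ E]

/-- The slice `{y | (x,y) ∈ O}`. -/
def slice (O : Set (E × E)) (x : E) : Set E := {y | (x, y) ∈ O}

/-- The covector `d_x c(x,y)`. -/
def dx (c : E → E → ℝ) (x y : E) : E →L[ℝ] ℝ := fderiv ℝ (fun x' => c x' y) x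

/-- The conditions (A0), (A1), (A2) on an open set `O`: `c` is of class `C⁴`, the map
`y ↦ d_x c(x,y)` is injective on each slice, and `v ↦ d_x d_y c(x,y)(v)` is injective. -/
structure SatisfiesA012 (c : E → E → ℝ) (O : Set (E × E)) : Prop where
  isOpen : IsOpen O
  a0 : ContDiffOn ℝ 4 (fun z : E × E => c z.1 z.2) O
  a1 : ∀ x : E, InjOn (fun y => dx c x y) (slice O x)
  a2 : ∀ x y : E, (x, y) ∈ O → Function.Injective (fderiv ℝ (fun y' => dx c x y') y)

/-- `K_x = {-d_x c(x,y) | y in the slice over x}`. -/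
def covectors (c : E → E → ℝ) (O : Set (E × E)) (x : E) : Set (E →L[ℝ] ℝ) :=
  (fun y => -dx c x y) '' slice O x

/-- The c-exponential `exp^c(x,α) = [d_x c(x,·)]⁻¹(-α)`, the inverse being taken on the slice. -/
def cExp (c : E → E → ℝ) (O : Set (E × E)) (x : E) (α : E →L[ℝ] ℝ) : E :=
  Function.invFunOn (fun y => dx c x y) (slice O x) (-α)

/-- The expression `-(3/2) ∂_s² ∂_t² c(γ(t), exp^c(x, α + s α₁))` at `s = t = 0`. The
cross-curvature `C_x(u,α,α₁)` is its value for any curve `γ` with `γ(0) = x` and `γ'(0) = u`. -/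
def crossCurvatureAlong (c : E → E → ℝ) (O : Set (E × E)) (x : E) (γ : ℝ → E)
    (α α₁ : E →L[ℝ] ℝ) : ℝ :=
  -(3 / 2) * iteratedDeriv 2
    (fun s : ℝ => iteratedDeriv 2 (fun t : ℝ => c (γ t) (cExp c O x (α + s • α₁))) 0) 0

/-- `r` is a value of the cross-curvature `C_x(u,α,α₁)` of `c` on `O`, computed along some smooth
curve with initial point `x` and initial velocity `u`. The sign conditions below are imposed on
all these values, so that they do not depend on a choice of the curve. -/
def IsCrossCurvature (c : E → E → ℝ) (O : Set (E × E)) (x u : E) (α α₁ : E →L[ℝ] ℝ)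
    (r : ℝ) : Prop :=
  ∃ γ : ℝ → E, ContDiff ℝ ∞ γ ∧ γ 0 = x ∧ deriv γ 0 = u ∧ r = crossCurvatureAlong c O x γ α α₁

/-- (A3w), the weak MTW condition. -/
def SatisfiesA3w (c : E → E → ℝ) (O : Set (E × E)) : Prop :=
  ∀ (x u : E) (α α₁ : E →L[ℝ] ℝ) (r : ℝ), α ∈ covectors c O x → α₁ u = 0 →
    IsCrossCurvature c O x u α α₁ r → 0 ≤ r

/-- (A3s), the strong MTW condition. -/
def SatisfiesA3s (c : E → E → ℝ) (O : Set (E × E)) : Prop :=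
  SatisfiesA3w c O ∧
  ∀ (x u : E) (α α₁ : E →L[ℝ] ℝ), α ∈ covectors c O x → α₁ u = 0 →
    IsCrossCurvature c O x u α α₁ 0 → u = 0 ∨ α₁ = 0

/-- (B3w): `c` is non-negatively cross-curved. -/
def SatisfiesB3w (c : E → E → ℝ) (O : Set (E × E)) : Prop :=
  ∀ (x u : E) (α α₁ : E →L[ℝ] ℝ) (r : ℝ), α ∈ covectors c O x →
    IsCrossCurvature c O x u α α₁ r → 0 ≤ r

/-- (B3s): `c` is positively cross-curved. -/
def SatisfiesB3s (c : E → E → ℝ) (O : Set (E × E)) : Prop :=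
  SatisfiesB3w c O ∧
  ∀ (x u : E) (α α₁ : E →L[ℝ] ℝ), α ∈ covectors c O x →
    IsCrossCurvature c O x u α α₁ 0 → u = 0 ∨ α₁ = 0

end Cost

/-! ### The perturbed free action -/

section Perturbed

variable {E : Type*} [NormedAddCommGroup E] [InnerProductSpace ℝ E] [CompleteSpace E]

/-- `L_ε(x,v) = ½|v|² - ε V(x)`. -/
def lagrangian (V : E → ℝ) (ε : ℝ) (x v : E) : ℝ := 1 / 2 * ‖v‖ ^ 2 - ε * V x

/-- `H_ε(x,v) = ½|v|² + ε V(x)`. -/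
def hamiltonian (V : E → ℝ) (ε : ℝ) (z : E × E) : ℝ := 1 / 2 * ‖z.2‖ ^ 2 + ε * V z.1

/-- The cost `c_ε` of the Lagrangian `L_ε`. -/
def cost (V : E → ℝ) (ε : ℝ) : E → E → ℝ := actionCost (lagrangian V ε)

/-- The Hessian of `V` at `x`, as an operator: the derivative of the gradient. -/
def hess (V : E → ℝ) (x : E) : E →L[ℝ] E := fderiv ℝ (gradient V) x

/-- `∫₀¹ ∫₀^τ ⟨u, (1-t) ∂_s² Hess V_{x+t(v+sw)} u⟩ dt dτ` at `s = 0`. -/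
def perturbIntegral (V : E → ℝ) (x v u w : E) : ℝ :=
  ∫ τ in (0 : ℝ)..1, ∫ t in (0 : ℝ)..τ,
    ⟪u, ((1 - t) • iteratedDeriv 2 (fun s : ℝ => hess V (x + t • (v + s • w))) 0) u⟫_ℝ

/-- `K_ε = {(x, Φ_1^ε(x,α)) | (x,α) ∈ W}`; it is used with `W = U_ε ∩ U`. -/
def targetSet (V : E → ℝ) (ε : ℝ) (W : Set (E × E)) : Set (E × E) :=
  (fun z : E × E => (z.1, flowProj (hamiltonian V ε) 1 z)) '' W

end Perturbed

end MTW

end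

/-! Write `W` for the admissible set `Ueps ε ∩ U`, `Φ` for the time-one endpoint and `y = Φ(x,p)`.
Regularity says that `c_ε(x,y)` is the action of the Newton path with initial data `(x,p) ∈ W`. The
first variation formula then makes `c_ε` a generating function, `dc = ⟨P, dy⟩ - ⟨p, dx⟩` with `P`
the final momentum. Hence `-d_x c = p` and the c-exponential is `Φ(x,·)`. Since `∂Φ/∂p` is
invertible, the inverse function theorem gives openness and (A0)–(A2)
(`IsGenerating.satisfiesA012`).

Moving `x` with velocity `u` at fixed endpoint `y` moves the initial momentum with velocity `-(u + ε
M u)`, where `M = M(x,p,ε)` is `shootingOp`. So `∂_t² c(γ(t),y) = ⟨u + ε M u, u⟩ - ⟨p, γ''⟩`. The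
last term is affine in `p`, so `∂_s²` kills it, and with `α₁ = ⟨w,·⟩` the cross-curvature is exactly
`-(3/2) ε ∂_s² ⟨M(x, p + s w, ε) u, u⟩` at `s = 0` (`exists_of_isCrossCurvature`). Only the sign of
this second derivative matters.

The factor `ε` has been extracted exactly, and `M` remains `C⁴` up to and across `ε = 0`. There the
paths are straight lines, `M u` is the double integral of `(t - 1) Hess V(x + t p) u`, and the
second derivative is minus the integral in (*) (`shootingCurvature_free`), hence at most `-C` for
unit vectors. Continuity and compactness of the closure of `U` and of the unit spheres preserve
negativity for small `ε` (`exists_shootingCurvature_neg`); homogeneity covers all nonzero `u` and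
`w`.

Smooth dependence on `(x,p,ε)` comes from the implicit function theorem for the integral form of
Newton's equation in `C([0,1], E)`, where superposition operators are smooth. -/

namespace MTW
open Filter Topology

/-! ### Costs given by a generating function: (A0)–(A2) and cross-curvature -/

section Generating

variable {E : Type*} [NormedAddCommGroup E] [InnerProductSpace ℝ E]

/-- The cost `c` is generated over the open set `W` of initial conditions by the endpoint map `Φ`
and the action `a`, with final momentum `P`. -/
structure IsGenerating (c : E → E → ℝ) (W : Set (E × E)) (Φ : E × E → E) (a : E × E → ℝ)
    (P : E × E → E) : Prop where
  isOpen : IsOpen W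
  contDiffAt : ∀ z ∈ W, ContDiffAt ℝ 4 Φ z
  contDiffAt_action : ∀ z ∈ W, ContDiffAt ℝ 4 a z
  isInvertible : ∀ z ∈ W, (fderiv ℝ Φ z ∘L .inr ℝ E E).IsInvertible
  cost_eq : ∀ z ∈ W, c z.1 (Φ z) = a z
  fderiv_action : ∀ z ∈ W, ∀ ξ η : E,
    fderiv ℝ a z (ξ, η) = ⟪P z, fderiv ℝ Φ z (ξ, η)⟫_ℝ - ⟪z.2, ξ⟫_ℝ

/-- The map that sends initial conditions to the pair of endpoints. -/
def endpoints (Φ : E × E → E) (z : E × E) : E × E := (z.1, Φ z)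

variable {c : E → E → ℝ} {W : Set (E × E)} {Φ : E × E → E} {a : E × E → ℝ} {P : E × E → E}

theorem fderiv_prod_apply (Φ : E × E → E) (z : E × E) (ξ η : E) :
    fderiv ℝ Φ z (ξ, η) = fderiv ℝ Φ z (ξ, 0) + fderiv ℝ Φ z (0, η) := by
  rw [← map_add]; simp

namespace IsGenerating

variable (h : IsGenerating c W Φ a P)
include h

theorem contDiffAt_endpoints {z : E × E} (hz : z ∈ W) : ContDiffAt ℝ 4 (endpoints Φ) z :=
  contDiffAt_fst.prodMk (h.contDiffAt z hz)

theorem hasFDerivAt_endpoints {z : E × E} (hz : z ∈ W) :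
    HasFDerivAt (endpoints Φ) ((ContinuousLinearMap.fst ℝ E E).prod (fderiv ℝ Φ z)) z :=
  hasFDerivAt_fst.prodMk ((h.contDiffAt z hz).differentiableAt (by norm_num)).hasFDerivAt

/-- The derivative of `(x,p) ↦ (x, Φ(x,p))` is block triangular with diagonal blocks the identity
and `∂Φ/∂p`. -/
theorem exists_equiv_endpoints {z : E × E} (hz : z ∈ W) :
    ∃ e : (E × E) ≃L[ℝ] (E × E), HasFDerivAt (endpoints Φ) (e : E × E →L[ℝ] E × E) z := by
  obtain ⟨A, hA⟩ := h.isInvertible z hz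
  refine ⟨(ContinuousLinearEquiv.refl ℝ E).skewProd A (fderiv ℝ Φ z ∘L .inl ℝ E E), ?_⟩
  convert h.hasFDerivAt_endpoints hz using 1
  refine ContinuousLinearMap.ext fun x => Prod.ext (by simp) ?_
  have h1 : A x.2 = fderiv ℝ Φ z (0, x.2) := by
    simpa using congrArg (fun f => f x.2) hA
  have h2 := fderiv_prod_apply Φ z x.1 x.2
  simp [h1, h2, add_comm]

variable [CompleteSpace E]

theorem exists_localInverse {z : E × E} (hz : z ∈ W) :
    ∃ g : E × E → E × E, ContDiffAt ℝ 4 g (endpoints Φ z) ∧ g (endpoints Φ z) = z ∧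
      ∀ᶠ y in 𝓝 (endpoints Φ z), endpoints Φ (g y) = y ∧ g y ∈ W := by
  obtain ⟨e, he⟩ := h.exists_equiv_endpoints hz
  have hc := h.contDiffAt_endpoints hz
  have hs := hc.hasStrictFDerivAt' he (by norm_num)
  have hg : ContDiffAt ℝ 4 (hc.localInverse he (by norm_num)) (endpoints Φ z) :=
    hc.to_localInverse he (by norm_num)
  have hgz : hc.localInverse he (by norm_num) (endpoints Φ z) = z :=
    hs.localInverse_apply_image
  refine ⟨_, hg, hgz, ?_⟩
  refine hs.eventually_right_inverse.and ?_
  have := hg.continuousAt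
  refine this.eventually ?_
  rw [hgz]
  exact h.isOpen.mem_nhds hz

theorem isOpen_image : IsOpen (endpoints Φ '' W) := by
  rw [isOpen_iff_mem_nhds]
  rintro _ ⟨z, hz, rfl⟩
  obtain ⟨g, -, -, hg⟩ := h.exists_localInverse hz
  filter_upwards [hg] with y hy
  exact ⟨g y, hy.2, hy.1⟩

/-- Near an endpoint pair the cost is the action composed with the local inverse of the endpoint
map. -/
theorem contDiffAt_cost {z : E × E} (hz : z ∈ W) :
    ContDiffAt ℝ 4 (fun y : E × E => c y.1 y.2) (endpoints Φ z) := by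
  obtain ⟨g, hgc, hgz, hg⟩ := h.exists_localInverse hz
  have h1 : ContDiffAt ℝ 4 a (g (endpoints Φ z)) := by
    rw [hgz]; exact h.contDiffAt_action z hz
  refine (h1.comp _ hgc).congr_of_eventuallyEq ?_
  filter_upwards [hg] with y hy
  have := h.cost_eq (g y) hy.2
  have h2 : (g y).1 = y.1 := (Prod.ext_iff.1 hy.1).1
  have h3 : Φ (g y) = y.2 := (Prod.ext_iff.1 hy.1).2
  rw [h2, h3] at this
  exact this

theorem fderiv_cost {z : E × E} (hz : z ∈ W) (ξ ζ : E) :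
    fderiv ℝ (fun y : E × E => c y.1 y.2) (endpoints Φ z) (ξ, ζ) =
      ⟪P z, ζ⟫_ℝ - ⟪z.2, ξ⟫_ℝ := by
  have h1 := ((h.contDiffAt_cost hz).differentiableAt (by norm_num)).hasFDerivAt
  have h2 := h1.comp z (h.hasFDerivAt_endpoints hz)
  have h3 : (fun y : E × E => c y.1 y.2) ∘ endpoints Φ =ᶠ[𝓝 z] a := by
    filter_upwards [h.isOpen.mem_nhds hz] with y hy using h.cost_eq y hy
  have h4 := (h2.congr_of_eventuallyEq h3.symm).fderiv
  obtain ⟨A, hA⟩ := h.isInvertible z hz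
  -- Invertibility of `∂Φ/∂p` realises every endpoint variation `(ξ, ζ)` by a variation of the
  -- initial data.
  set η : E := A.symm (ζ - fderiv ℝ Φ z (ξ, 0)) with hη
  have h5 : fderiv ℝ Φ z (ξ, η) = ζ := by
    have : fderiv ℝ Φ z (0, η) = A η := by
      have := congrArg (fun f => f η) hA
      simpa using this.symm
    rw [fderiv_prod_apply, this, hη]
    simp
  have h6 := h.fderiv_action z hz ξ η
  rw [h4, h5] at h6
  simpa [h5] using h6

theorem hasFDerivAt_cost_left {z : E × E} (hz : z ∈ W) :
    HasFDerivAt (fun x => c x (Φ z)) (-innerSL ℝ z.2) z.1 := by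
  have h1 := ((h.contDiffAt_cost hz).differentiableAt (by norm_num)).hasFDerivAt
  have h2 : HasFDerivAt (fun x : E => (x, Φ z)) (ContinuousLinearMap.inl ℝ E E) z.1 :=
    hasFDerivAt_prodMk_left z.1 (Φ z)
  have h3 := HasFDerivAt.comp z.1 (f := fun x : E => (x, Φ z)) h1 h2
  have h4 : fderiv ℝ (fun y : E × E => c y.1 y.2) (z.1, Φ z) ∘L .inl ℝ E E =
      -innerSL ℝ z.2 := by
    ext ξ
    have := h.fderiv_cost hz ξ 0
    simpa [endpoints] using this
  rw [← h4]
  exact h3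

theorem dx_eq {z : E × E} (hz : z ∈ W) : dx c z.1 (Φ z) = -innerSL ℝ z.2 :=
  (h.hasFDerivAt_cost_left hz).fderiv

/-- The initial momentum is a smooth function of the endpoints. -/
theorem exists_momentum {z : E × E} (hz : z ∈ W) :
    ∃ π : E × E → E, ContDiffAt ℝ 4 π (endpoints Φ z) ∧ π (endpoints Φ z) = z.2 ∧
      (∀ᶠ y in 𝓝 (endpoints Φ z), dx c y.1 y.2 = -innerSL ℝ (π y) ∧
        HasFDerivAt (fun x => c x y.2) (-innerSL ℝ (π y)) y.1) ∧
      ∀ ξ η : E, fderiv ℝ π (endpoints Φ z) (ξ, fderiv ℝ Φ z (ξ, η)) = η := by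
  obtain ⟨g, hgc, hgz, hg⟩ := h.exists_localInverse hz
  have hπc : ContDiffAt ℝ 4 (fun y => (g y).2) (endpoints Φ z) := contDiffAt_snd.comp _ hgc
  have hev : ∀ᶠ y in 𝓝 (endpoints Φ z), dx c y.1 y.2 = -innerSL ℝ (g y).2 ∧
        HasFDerivAt (fun x => c x y.2) (-innerSL ℝ (g y).2) y.1 := by
    filter_upwards [hg] with y hy
    have h0 := h.hasFDerivAt_cost_left hy.2
    have h2 : (g y).1 = y.1 := (Prod.ext_iff.1 hy.1).1
    have h3 : Φ (g y) = y.2 := (Prod.ext_iff.1 hy.1).2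
    rw [h2, h3] at h0
    exact ⟨h0.fderiv, h0⟩
  refine ⟨fun y => (g y).2, hπc, by simp [hgz], hev, fun ξ η => ?_⟩
  have hcont : ContinuousAt (endpoints Φ) z := (h.contDiffAt_endpoints hz).continuousAt
  -- Two expressions for the same covector `d_x c` force the two momenta to agree; differentiating
  -- this identity gives the last claim.
  have hleft : (fun y => (g y).2) ∘ endpoints Φ =ᶠ[𝓝 z] Prod.snd := by
    filter_upwards [hcont.eventually hev, h.isOpen.mem_nhds hz] with y hy hyW
    have h1 := h.dx_eq hyW
    have h2 := hy.1
    simp only [endpoints] at h2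
    rw [h1, neg_inj] at h2
    exact ((innerSL_inj).1 h2).symm
  have h1 := (hπc.differentiableAt (by norm_num)).hasFDerivAt
  have h2 := ((h1.comp z (h.hasFDerivAt_endpoints hz)).congr_of_eventuallyEq hleft.symm).unique
    hasFDerivAt_snd
  have := congrArg (fun f => f (ξ, η)) h2
  simpa using this

/-- Injectivity in (A1) holds because `d_x c` determines `p`, and `p` determines the endpoint. For
(A2), `∂π/∂y` has `∂Φ/∂p` as a left inverse. -/
theorem satisfiesA012 : SatisfiesA012 c (endpoints Φ '' W) where
  isOpen := h.isOpen_image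
  a0 := by
    rintro _ ⟨z, hz, rfl⟩
    exact (h.contDiffAt_cost hz).contDiffWithinAt
  a1 := by
    rintro x y₁ ⟨z₁, hz₁, he₁⟩ y₂ ⟨z₂, hz₂, he₂⟩ heq
    obtain ⟨rfl, rfl⟩ := Prod.mk.inj he₁
    obtain ⟨h1, rfl⟩ := Prod.mk.inj he₂
    have d1 := h.dx_eq hz₁
    have d2 := h.dx_eq hz₂
    simp only at heq
    rw [h1, ← heq, d1, neg_inj] at d2
    have h2 := (innerSL_inj).1 d2
    rw [show z₁ = z₂ from Prod.ext h1.symm h2]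
  a2 := by
    rintro x y ⟨z, hz, he⟩
    obtain ⟨rfl, rfl⟩ := Prod.mk.inj he
    obtain ⟨π, hπc, -, hev, hπ⟩ := h.exists_momentum hz
    have hπd := (hπc.differentiableAt (by norm_num)).hasFDerivAt
    have h2 : HasFDerivAt (fun y : E => (z.1, y)) (ContinuousLinearMap.inr ℝ E E) (Φ z) :=
      hasFDerivAt_prodMk_right z.1 (Φ z)
    have h3 := HasFDerivAt.comp (Φ z) (f := fun y : E => (z.1, y)) hπd h2
    have h4 := ((innerSL ℝ (E := E)).hasFDerivAt.comp (Φ z) h3).neg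
    have h5 : (fun y' => dx c z.1 y') =ᶠ[𝓝 (Φ z)]
        -((innerSL ℝ (E := E)) ∘ π ∘ fun y : E => (z.1, y)) := by
      have : Tendsto (fun y : E => (z.1, y)) (𝓝 (Φ z)) (𝓝 (endpoints Φ z)) :=
        (Continuous.prodMk_right z.1).tendsto _
      filter_upwards [this.eventually hev] with y hy
      simp [hy.1]
    rw [(h4.congr_of_eventuallyEq h5).fderiv]
    obtain ⟨A, hA⟩ := h.isInvertible z hz
    have hinv : ∀ v : E, A (fderiv ℝ π (endpoints Φ z) (0, v)) = v := fun v => by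
      have h6 := hπ 0 (A.symm v)
      have h7 : fderiv ℝ Φ z (0, A.symm v) = v := by
        have := congrArg (fun f => f (A.symm v)) hA
        simpa using this.symm
      rw [h7] at h6
      rw [h6]; simp
    intro v₁ v₂ hv
    have hv' : innerSL ℝ (fderiv ℝ π (endpoints Φ z) (0, v₁)) =
        innerSL ℝ (fderiv ℝ π (endpoints Φ z) (0, v₂)) := by
      have := neg_inj.1 hv
      exact this
    have := (innerSL_inj).1 hv'
    rw [← hinv v₁, ← hinv v₂, this]

theorem cExp_eq {z : E × E} (hz : z ∈ W) :
    cExp c (endpoints Φ '' W) z.1 (innerSL ℝ z.2) = Φ z := by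
  have h1 : dx c z.1 (Φ z) = -innerSL ℝ z.2 := h.dx_eq hz
  have hmem : Φ z ∈ slice (endpoints Φ '' W) z.1 := ⟨z, hz, rfl⟩
  have hex : ∃ y ∈ slice (endpoints Φ '' W) z.1, dx c z.1 y = -innerSL ℝ z.2 :=
    ⟨Φ z, hmem, h1⟩
  have h2 := Function.invFunOn_mem hex
  have h3 := Function.invFunOn_eq hex
  exact h.satisfiesA012.a1 z.1 h2 (hmem) (h3.trans h1.symm)

/-- The first derivative is `-⟨π, γ'⟩`. The condition on `η` says that the momentum `π` has velocity
`-η` when the initial point has velocity `γ'(0)` and the endpoint is fixed. -/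
theorem iteratedDeriv_cost_comp {z : E × E} (hz : z ∈ W) {γ : ℝ → E} (hγ : ContDiff ℝ ∞ γ)
    (h0 : γ 0 = z.1) {η : E} (hη : fderiv ℝ Φ z (deriv γ 0, -η) = 0) :
    iteratedDeriv 2 (fun t => c (γ t) (Φ z)) 0 =
      ⟪η, deriv γ 0⟫_ℝ - ⟪z.2, deriv (deriv γ) 0⟫_ℝ := by
  obtain ⟨π, hπc, hπz, hev, hπ⟩ := h.exists_momentum hz
  have hγ1 : ∀ t, HasDerivAt γ (deriv γ t) t := fun t =>
    (hγ.differentiable (by simp) t).hasDerivAt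
  have hγ2 : HasDerivAt (deriv γ) (deriv (deriv γ) 0) 0 := by
    have : ContDiff ℝ ∞ (deriv γ) := (contDiff_infty_iff_deriv.1 hγ).2
    exact (this.differentiable (by simp) 0).hasDerivAt
  have hcurve : HasDerivAt (fun t => (γ t, Φ z)) (deriv γ 0, (0 : E)) 0 :=
    (hγ1 0).prodMk (hasDerivAt_const _ _)
  have hpt : (γ 0, Φ z) = endpoints Φ z := by rw [h0]; rfl
  have hev' : ∀ᶠ t in 𝓝 (0 : ℝ), HasFDerivAt (fun x => c x (Φ z)) (-innerSL ℝ (π (γ t, Φ z))) (γ t) := by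
    have h1 : Tendsto (fun t => (γ t, Φ z)) (𝓝 0) (𝓝 (endpoints Φ z)) := by
      rw [← hpt]; exact hcurve.continuousAt
    filter_upwards [h1.eventually hev] with t ht using ht.2
  have hd : deriv (fun t => c (γ t) (Φ z)) =ᶠ[𝓝 0]
      fun t => -⟪π (γ t, Φ z), deriv γ t⟫_ℝ := by
    filter_upwards [hev'] with t ht
    have := (ht.comp_hasDerivAt t (hγ1 t)).deriv
    simpa [Function.comp_def] using this
  rw [iteratedDeriv_succ, iteratedDeriv_one, hd.deriv_eq]
  have hπd : HasFDerivAt π (fderiv ℝ π (endpoints Φ z)) (γ 0, Φ z) := by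
    rw [hpt]; exact (hπc.differentiableAt (by norm_num)).hasFDerivAt
  have h3 := hπd.comp_hasDerivAt (0 : ℝ) hcurve
  have h4 : fderiv ℝ π (endpoints Φ z) (deriv γ 0, 0) = -η := by
    rw [← hπ (deriv γ 0) (-η), hη]
  rw [h4] at h3
  have h5 := (h3.inner ℝ hγ2).neg.deriv
  refine h5.trans ?_
  simp only [Function.comp_apply]
  rw [hpt, hπz]
  simp
  ring

/-- The acceleration of `γ` enters through a term affine in `s`, so its second derivative vanishes;
this is why the choice of curve is immaterial. -/
theorem crossCurvatureAlong_eq {x p w : E} (hz : (x, p) ∈ W) {γ : ℝ → E} (hγ : ContDiff ℝ ∞ γ)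
    (h0 : γ 0 = x) {f : ℝ → ℝ} (hf : ContDiffAt ℝ 2 f 0)
    (hfeq : ∀ᶠ s in 𝓝 (0 : ℝ), ∃ η : E,
      fderiv ℝ Φ (x, p + s • w) (deriv γ 0, -η) = 0 ∧ f s = ⟪η, deriv γ 0⟫_ℝ) :
    crossCurvatureAlong c (endpoints Φ '' W) x γ (innerSL ℝ p) (innerSL ℝ w) =
      -(3 / 2) * iteratedDeriv 2 f 0 := by
  unfold crossCurvatureAlong
  congr 1
  have hW : ∀ᶠ s in 𝓝 (0 : ℝ), (x, p + s • w) ∈ W := by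
    have : ContinuousAt (fun s : ℝ => (x, p + s • w)) 0 := by fun_prop
    refine this.eventually ?_
    simpa using h.isOpen.mem_nhds hz
  set β : E := deriv (deriv γ) 0
  have hev : (fun s : ℝ => iteratedDeriv 2 (fun t : ℝ => c (γ t)
      (cExp c (endpoints Φ '' W) x (innerSL ℝ p + s • innerSL ℝ w))) 0) =ᶠ[𝓝 0]
      f + fun s => -(⟪p, β⟫_ℝ + s * ⟪w, β⟫_ℝ) := by
    filter_upwards [hW, hfeq] with s hs ⟨η, hη, hfs⟩
    have h1 : innerSL ℝ p + s • innerSL ℝ w = innerSL ℝ (p + s • w) := by simp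
    rw [h1, h.cExp_eq hs, h.iteratedDeriv_cost_comp hs hγ h0 hη, Pi.add_apply, hfs]
    simp [inner_add_left, inner_smul_left, β]
    ring
  rw [hev.iteratedDeriv_eq, iteratedDeriv_add hf (by fun_prop)]
  have : iteratedDeriv 2 (fun s : ℝ => -(⟪p, β⟫_ℝ + s * ⟪w, β⟫_ℝ)) 0 = 0 := by
    have hd : deriv (fun s : ℝ => -(⟪p, β⟫_ℝ + s * ⟪w, β⟫_ℝ)) = fun _ => -⟪w, β⟫_ℝ := by
      ext s
      have := (((hasDerivAt_id s).mul_const ⟪w, β⟫_ℝ).const_add ⟪p, β⟫_ℝ).neg.deriv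
      exact this.trans (by simp)
    rw [iteratedDeriv_succ, iteratedDeriv_one, hd]
    simp
  rw [this, add_zero]

end IsGenerating

end Generating

open unitInterval

/-! ### Smoothness of superposition operators on spaces of continuous functions -/

section Superposition

open Classical in
/-- The superposition operator `q ↦ f ∘ q` on continuous maps; it is only used for continuous
functions `f`. -/
noncomputable def superpose (X : Type*) {E F : Type*} [TopologicalSpace X] [TopologicalSpace E]
    [TopologicalSpace F] [Zero F] (f : E → F) (q : C(X, E)) : C(X, F) :=
  if hf : Continuous f then (⟨f, hf⟩ : C(E, F)).comp q else 0

theorem superpose_apply {X E F : Type*} [TopologicalSpace X] [TopologicalSpace E]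
    [TopologicalSpace F] [Zero F] {f : E → F} (hf : Continuous f) (q : C(X, E)) (t : X) :
    superpose X f q t = f (q t) := by
  simp [superpose, hf]

theorem continuous_superpose {X E F : Type*} [TopologicalSpace X] [TopologicalSpace E]
    [TopologicalSpace F] [Zero F] {f : E → F} (hf : Continuous f) : Continuous (superpose X f) := by
  have : superpose X f = (⟨f, hf⟩ : C(E, F)).comp := by
    ext q t; simp [superpose_apply hf]
  rw [this]
  exact ContinuousMap.continuous_postcomp _

variable {X : Type*} [TopologicalSpace X] [CompactSpace X]

/-- Pointwise application of a continuous family of linear maps, as a bilinear map. -/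
noncomputable def pointwiseApply (X : Type*) [TopologicalSpace X] [CompactSpace X] (E F : Type*)
    [NormedAddCommGroup E] [NormedSpace ℝ E] [NormedAddCommGroup F] [NormedSpace ℝ F] :
    C(X, E →L[ℝ] F) →L[ℝ] C(X, E) →L[ℝ] C(X, F) :=
  LinearMap.mkContinuous₂
    (LinearMap.mk₂ ℝ
      (fun (A : C(X, E →L[ℝ] F)) (h : C(X, E)) => (⟨fun t => A t (h t), by fun_prop⟩ : C(X, F)))
      (fun _ _ _ => by ext; simp) (fun _ _ _ => by ext; simp)
      (fun _ _ _ => by ext; simp) (fun _ _ _ => by ext; simp)) 1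
    (fun A h => by
      rw [ContinuousMap.norm_le _ (by positivity)]
      intro t
      calc ‖A t (h t)‖ ≤ ‖A t‖ * ‖h t‖ := (A t).le_opNorm _
        _ ≤ ‖A‖ * ‖h‖ := by gcongr <;> exact ContinuousMap.norm_coe_le_norm _ t
        _ = 1 * ‖A‖ * ‖h‖ := by ring)

variable {E F : Type*} [NormedAddCommGroup E] [NormedSpace ℝ E]
  [NormedAddCommGroup F] [NormedSpace ℝ F]

@[simp] theorem pointwiseApply_apply (A : C(X, E →L[ℝ] F)) (h : C(X, E)) (t : X) :
    pointwiseApply X E F A h t = A t (h t) := rfl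

theorem hasFDerivAt_superpose {f : E → F} (hf : ContDiff ℝ 1 f) (q : C(X, E)) :
    HasFDerivAt (superpose X f) (pointwiseApply X E F (superpose X (fderiv ℝ f) q)) q := by
  have hf' : Continuous (fderiv ℝ f) := hf.continuous_fderiv (by norm_num)
  rw [hasFDerivAt_iff_isLittleO_nhds_zero, Asymptotics.isLittleO_iff]
  intro ε hε
  have hc : ContinuousAt (superpose X (fderiv ℝ f)) q := (continuous_superpose hf').continuousAt
  obtain ⟨δ, hδ, hball⟩ := (Metric.continuousAt_iff (f := superpose X (fderiv ℝ f)) (a := q)).1 hc ε hε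
  filter_upwards [Metric.ball_mem_nhds (0 : C(X, E)) hδ] with h hh
  rw [mem_ball_zero_iff] at hh
  rw [ContinuousMap.norm_le _ (by positivity)]
  intro t
  have key : ∀ y ∈ Metric.ball (q t) δ, ‖fderiv ℝ f y - fderiv ℝ f (q t)‖ ≤ ε := by
    intro y hy
    -- Translating `q` by a constant gives a nearby map with value `y` at `t`, so continuity in the
    -- sup norm yields a bound uniform in `t`.
    have h1 : dist (q + ContinuousMap.const X (y - q t)) q < δ := by
      rw [dist_eq_norm, add_sub_cancel_left]
      refine lt_of_le_of_lt ?_ (mem_ball_iff_norm.1 hy)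
      rw [ContinuousMap.norm_le _ (norm_nonneg _)]
      intro s; simp
    have h2 := (ContinuousMap.dist_apply_le_dist t).trans (hball h1).le
    rw [superpose_apply hf', superpose_apply hf', dist_eq_norm] at h2
    simpa using h2
  have hht : ‖h t‖ ≤ ‖h‖ := ContinuousMap.norm_coe_le_norm h t
  have h3 := Convex.norm_image_sub_le_of_norm_hasFDerivWithin_le' (𝕜 := ℝ) (f := f)
    (s := Metric.ball (q t) δ) (x := q t) (y := q t + h t) (φ := fderiv ℝ f (q t)) (C := ε)
    (fun y _ => (hf.differentiable (by norm_num) y).hasFDerivAt.hasFDerivWithinAt) key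
    (convex_ball _ _) (Metric.mem_ball_self hδ)
    (by rw [mem_ball_iff_norm, add_sub_cancel_left]; exact hht.trans_lt hh)
  rw [add_sub_cancel_left] at h3
  simp only [ContinuousMap.sub_apply, superpose_apply hf.continuous, ContinuousMap.add_apply,
    pointwiseApply_apply, superpose_apply hf']
  exact h3.trans (by gcongr)

end Superposition

/-- The derivative of a superposition operator is built from superposition with `fderiv ℝ f`, so
induction applies with `F` replaced by `E →L[ℝ] F`; this keeps `E` and `F` in one universe. -/
theorem contDiff_superpose_nat {X : Type*} [TopologicalSpace X] [CompactSpace X]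
    {E F : Type} [NormedAddCommGroup E] [NormedSpace ℝ E]
    [NormedAddCommGroup F] [NormedSpace ℝ F] (n : ℕ) {f : E → F} (hf : ContDiff ℝ n f) :
    ContDiff ℝ n (superpose X f) := by
  induction n generalizing F with
  | zero =>
    rw [Nat.cast_zero, contDiff_zero] at hf ⊢
    exact continuous_superpose hf
  | succ n ih =>
    have h1 : ContDiff ℝ 1 f := hf.of_le (by norm_cast; omega)
    rw [Nat.cast_add, Nat.cast_one] at hf ⊢
    rw [contDiff_succ_iff_hasFDerivAt]
    refine ⟨_, ?_, hasFDerivAt_superpose h1⟩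
    exact (pointwiseApply X E F).contDiff.comp (ih (hf.fderiv_right le_rfl))

theorem contDiff_superpose {X : Type*} [TopologicalSpace X] [CompactSpace X]
    {E F : Type} [NormedAddCommGroup E] [NormedSpace ℝ E]
    [NormedAddCommGroup F] [NormedSpace ℝ F] {f : E → F} (hf : ContDiff ℝ ∞ f) :
    ContDiff ℝ ∞ (superpose X f) :=
  contDiff_infty.2 fun n => contDiff_superpose_nat n (contDiff_infty.1 hf n)

/-! ### The primitive of a continuous function on the unit interval -/

section Primitive

theorem continuous_comp_projIcc {F : Type*} [TopologicalSpace F] (f : C(I, F)) :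
    Continuous fun s : ℝ => f (projIcc 0 1 zero_le_one s) :=
  f.continuous.comp continuous_projIcc

variable {F : Type*} [NormedAddCommGroup F] [NormedSpace ℝ F]

/-- The primitive `t ↦ ∫₀ᵗ f` of a continuous function on the unit interval. -/
noncomputable def primitive (F : Type*) [NormedAddCommGroup F] [NormedSpace ℝ F] : C(I, F) →L[ℝ] C(I, F) :=
  LinearMap.mkContinuous
    { toFun := fun f => ⟨fun t => ∫ s in (0 : ℝ)..t, f (projIcc 0 1 zero_le_one s),
        (intervalIntegral.continuous_primitive
          (fun _ _ => (continuous_comp_projIcc f).intervalIntegrable _ _) 0).comp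
          continuous_subtype_val⟩
      map_add' := fun f g => by
        ext t
        exact intervalIntegral.integral_add
          ((continuous_comp_projIcc f).intervalIntegrable _ _)
          ((continuous_comp_projIcc g).intervalIntegrable _ _)
      map_smul' := fun r f => by
        ext t
        exact intervalIntegral.integral_smul _ _ } 1
    (fun f => by
      rw [ContinuousMap.norm_le _ (by positivity)]
      intro t
      refine (intervalIntegral.norm_integral_le_of_norm_le_const (C := ‖f‖)
        fun s _ => ContinuousMap.norm_coe_le_norm f _).trans ?_
      have h0 : |(t : ℝ) - 0| ≤ 1 := by
        rw [sub_zero, abs_of_nonneg t.2.1]; exact t.2.2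
      nlinarith [norm_nonneg f])

theorem primitive_apply (f : C(I, F)) (t : I) :
    primitive F f t = ∫ s in (0 : ℝ)..t, f (projIcc 0 1 zero_le_one s) := rfl

theorem primitive_const [CompleteSpace F] (v : F) (t : I) :
    primitive F (ContinuousMap.const I v) t = (t : ℝ) • v := by
  simp [primitive_apply]

@[simp] theorem primitive_apply_zero (f : C(I, F)) : primitive F f 0 = 0 := by
  simp [primitive_apply]

theorem primitive_comp_clm {G : Type*} [NormedAddCommGroup G] [NormedSpace ℝ G] [CompleteSpace F]
    [CompleteSpace G] (L : F →L[ℝ] G) (f : C(I, F)) :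
    primitive G (L.compLeftContinuous ℝ I f) = L.compLeftContinuous ℝ I (primitive F f) := by
  ext t
  exact L.intervalIntegral_comp_comm ((continuous_comp_projIcc f).intervalIntegrable _ _)

theorem hasDerivWithinAt_primitive [CompleteSpace F] (f : C(I, F)) {t : ℝ}
    (ht : t ∈ Icc (0 : ℝ) 1) :
    HasDerivWithinAt (fun s => primitive F f (projIcc 0 1 zero_le_one s))
      (f (projIcc 0 1 zero_le_one t)) (Icc 0 1) t := by
  have h1 := ((continuous_comp_projIcc f).integral_hasStrictDerivAt 0 t).hasDerivAt.hasDerivWithinAt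
    (s := Icc 0 1)
  refine h1.congr (fun s hs => ?_) ?_
  · rw [primitive_apply, projIcc_of_mem zero_le_one hs]
  · rw [primitive_apply, projIcc_of_mem zero_le_one ht]

/-- A continuous function with a given derivative is recovered from its primitive. -/
theorem eq_primitive_of_hasDerivWithinAt [CompleteSpace F] {f g : C(I, F)}
    (h0 : f 0 = 0)
    (h : ∀ t ∈ Icc (0 : ℝ) 1, HasDerivWithinAt (fun s => f (projIcc 0 1 zero_le_one s))
      (g (projIcc 0 1 zero_le_one t)) (Icc 0 1) t) : f = primitive F g := by
  have hcont : ContinuousOn (fun s => f (projIcc 0 1 zero_le_one s)) (Icc 0 1) :=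
    (continuous_comp_projIcc f).continuousOn
  ext t
  have h1 := intervalIntegral.integral_eq_sub_of_hasDeriv_right_of_le (a := 0) (b := t)
    (f := fun s => f (projIcc 0 1 zero_le_one s)) (f' := fun s => g (projIcc 0 1 zero_le_one s))
    t.2.1 (continuous_comp_projIcc f).continuousOn
    (fun s hs => by
      have hs' : s ∈ Ico (0 : ℝ) 1 := ⟨hs.1.le, hs.2.trans_le t.2.2⟩
      exact ((h s (Ico_subset_Icc_self hs')).mono_of_mem_nhdsWithin
        (Icc_mem_nhdsGT_of_mem hs')))
    ((continuous_comp_projIcc g).intervalIntegrable _ _)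
  rw [primitive_apply, h1]
  have h2 : projIcc (0 : ℝ) 1 zero_le_one 0 = 0 := projIcc_left _
  have h3 : projIcc (0 : ℝ) 1 zero_le_one t = t := projIcc_val _ t
  rw [h2, h3, h0, sub_zero]

end Primitive

/-! ### Uniqueness for autonomous equations -/

theorem eqOn_Icc_of_hasDerivWithinAt {G : Type*} [NormedAddCommGroup G] [NormedSpace ℝ G]
    {Y : G → G} (hY : ContDiff ℝ 1 Y) {z₁ z₂ : ℝ → G} {T : ℝ}
    (h₁ : ∀ t ∈ Icc 0 T, HasDerivWithinAt z₁ (Y (z₁ t)) (Icc 0 T) t)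
    (h₂ : ∀ t ∈ Icc 0 T, HasDerivWithinAt z₂ (Y (z₂ t)) (Icc 0 T) t) (h0 : z₁ 0 = z₂ 0) :
    EqOn z₁ z₂ (Icc 0 T) := by
  have c₁ : ContinuousOn z₁ (Icc 0 T) := fun t ht => (h₁ t ht).continuousWithinAt
  have c₂ : ContinuousOn z₂ (Icc 0 T) := fun t ht => (h₂ t ht).continuousWithinAt
  -- A `C¹` field is only locally Lipschitz; a global constant exists on the compact union of the
  -- two trajectories.
  have hK : IsCompact (z₁ '' Icc 0 T ∪ z₂ '' Icc 0 T) :=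
    (isCompact_Icc.image_of_continuousOn c₁).union (isCompact_Icc.image_of_continuousOn c₂)
  obtain ⟨K, hK⟩ := (hY.locallyLipschitz.locallyLipschitzOn).exists_lipschitzOnWith_of_compact hK
  refine ODE_solution_unique_of_mem_Icc_right (v := fun _ => Y) (K := K)
    (s := fun _ => z₁ '' Icc 0 T ∪ z₂ '' Icc 0 T) (fun _ _ => hK) c₁ (fun t ht => ?_)
    (fun t ht => Or.inl ⟨t, Ico_subset_Icc_self ht, rfl⟩) c₂ (fun t ht => ?_)
    (fun t ht => Or.inr ⟨t, Ico_subset_Icc_self ht, rfl⟩) h0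
  · exact (h₁ t (Ico_subset_Icc_self ht)).mono_of_mem_nhdsWithin (Icc_mem_nhdsGE_of_mem ht)
  · exact (h₂ t (Ico_subset_Icc_self ht)).mono_of_mem_nhdsWithin (Icc_mem_nhdsGE_of_mem ht)

theorem hasDerivAt_line {G : Type*} [NormedAddCommGroup G] [NormedSpace ℝ G] (a b : G) :
    HasDerivAt (fun s : ℝ => a + s • b) b 0 := by
  simpa only [one_smul, id] using ((hasDerivAt_id (0 : ℝ)).smul_const b).const_add a

/-! ### Newton's equation `q'' = -ε g(q)` for small `ε` -/

section Newton

variable {E : Type} [NormedAddCommGroup E] [NormedSpace ℝ E]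

/-- The momentum `p - ε ∫₀ᵗ g(q)` along `q`, for the parameters `z = (x, p, ε)`. -/
noncomputable def momentum (g : E → E) (z : E × E × ℝ) (q : C(I, E)) : C(I, E) :=
  ContinuousMap.const I z.2.1 - z.2.2 • primitive E (superpose I g q)

/-- The defect of the integral form of Newton's equation with parameters `z = (x, p, ε)`. -/
noncomputable def newtonDefect (g : E → E) (u : (E × E × ℝ) × C(I, E)) : C(I, E) :=
  u.2 - ContinuousMap.const I u.1.1 - primitive E (momentum g u.1 u.2)

/-- `q` solves the integral form of Newton's equation with parameters `z = (x, p, ε)`. -/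
noncomputable def IsNewtonPath (g : E → E) (z : E × E × ℝ) (q : C(I, E)) : Prop :=
  q = ContinuousMap.const I z.1 + primitive E (momentum g z q)

theorem isNewtonPath_iff {g : E → E} {z : E × E × ℝ} {q : C(I, E)} :
    IsNewtonPath g z q ↔ newtonDefect g (z, q) = 0 := by
  simp only [IsNewtonPath, newtonDefect]
  rw [sub_sub, sub_eq_zero]

/-- The phase space curve of `q`, extended to the real line. -/
noncomputable def phaseCurve (g : E → E) (z : E × E × ℝ) (q : C(I, E)) (t : ℝ) : E × E :=
  (q (projIcc 0 1 zero_le_one t), momentum g z q (projIcc 0 1 zero_le_one t))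

variable {g : E → E} {z : E × E × ℝ} {q : C(I, E)}

theorem contDiff_constMap : ContDiff ℝ ∞ (fun x : E => ContinuousMap.const I x) :=
  (ContinuousLinearMap.const (R := ℝ) (M := E) I).contDiff

theorem contDiff_momentum (hg : ContDiff ℝ ∞ g) :
    ContDiff ℝ ∞ (fun u : (E × E × ℝ) × C(I, E) => momentum g u.1 u.2) := by
  unfold momentum
  refine ContDiff.sub (contDiff_constMap.comp (contDiff_fst.comp (contDiff_snd.comp contDiff_fst)))
    (ContDiff.smul (contDiff_snd.comp (contDiff_snd.comp contDiff_fst)) ?_)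
  exact (primitive E).contDiff.comp ((contDiff_superpose hg).comp contDiff_snd)

theorem contDiff_newtonDefect (hg : ContDiff ℝ ∞ g) : ContDiff ℝ ∞ (newtonDefect g) := by
  unfold newtonDefect
  refine (contDiff_snd.sub (contDiff_constMap.comp (contDiff_fst.comp contDiff_fst))).sub ?_
  exact (primitive E).contDiff.comp (contDiff_momentum hg)

theorem IsNewtonPath.apply_zero (h : IsNewtonPath g z q) : q 0 = z.1 := by
  have := congrArg (fun f => f 0) h
  simpa using this

theorem momentum_apply_zero : momentum g z q 0 = z.2.1 := by
  simp [momentum]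

theorem projIcc_zero_eq : projIcc (0 : ℝ) 1 zero_le_one 0 = 0 := projIcc_left _
theorem projIcc_one_eq : projIcc (0 : ℝ) 1 zero_le_one 1 = 1 := projIcc_right _

theorem IsNewtonPath.phaseCurve_zero (h : IsNewtonPath g z q) :
    phaseCurve g z q 0 = (z.1, z.2.1) := by
  simp only [phaseCurve, projIcc_zero_eq]
  rw [h.apply_zero, momentum_apply_zero]

theorem IsNewtonPath.hasDerivWithinAt_position [CompleteSpace E] (h : IsNewtonPath g z q)
    {t : ℝ} (ht : t ∈ Icc (0 : ℝ) 1) :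
    HasDerivWithinAt (fun s => q (projIcc 0 1 zero_le_one s))
      (momentum g z q (projIcc 0 1 zero_le_one t)) (Icc 0 1) t := by
  have h1 := (hasDerivWithinAt_primitive (momentum g z q) ht).const_add z.1
  have h2 : (fun s => q (projIcc 0 1 zero_le_one s)) =
      fun s => z.1 + primitive E (momentum g z q) (projIcc 0 1 zero_le_one s) := by
    funext s
    exact congrArg (fun f => f (projIcc 0 1 zero_le_one s)) h
  rw [h2]
  exact h1

theorem hasDerivWithinAt_momentum [CompleteSpace E] (hg : Continuous g) (z : E × E × ℝ)
    (q : C(I, E)) {t : ℝ} (ht : t ∈ Icc (0 : ℝ) 1) :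
    HasDerivWithinAt (fun s => momentum g z q (projIcc 0 1 zero_le_one s))
      (-(z.2.2 • g (q (projIcc 0 1 zero_le_one t)))) (Icc 0 1) t := by
  have h1 := ((hasDerivWithinAt_primitive (superpose I g q) ht).const_smul z.2.2).const_sub z.2.1
  rw [superpose_apply hg] at h1
  exact h1

theorem IsNewtonPath.hasDerivWithinAt [CompleteSpace E] (hg : Continuous g)
    (h : IsNewtonPath g z q) {t : ℝ} (ht : t ∈ Icc (0 : ℝ) 1) :
    HasDerivWithinAt (phaseCurve g z q)
      ((phaseCurve g z q t).2, -(z.2.2 • g (phaseCurve g z q t).1)) (Icc 0 1) t :=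
  (h.hasDerivWithinAt_position ht).prodMk (hasDerivWithinAt_momentum hg z q ht)

theorem IsNewtonPath.unique [CompleteSpace E] (hg : ContDiff ℝ 1 g) {q₁ q₂ : C(I, E)}
    (h₁ : IsNewtonPath g z q₁) (h₂ : IsNewtonPath g z q₂) : q₁ = q₂ := by
  have hY : ContDiff ℝ 1 (fun y : E × E => (y.2, -(z.2.2 • g y.1))) := by fun_prop
  have h := eqOn_Icc_of_hasDerivWithinAt hY (T := 1)
    (fun t ht => h₁.hasDerivWithinAt hg.continuous ht)
    (fun t ht => h₂.hasDerivWithinAt hg.continuous ht)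
    (by rw [h₁.phaseCurve_zero, h₂.phaseCurve_zero])
  ext t
  have h3 := congrArg Prod.fst (h t.2)
  simpa [phaseCurve] using h3

theorem isNewtonPath_free (x p : E) :
    IsNewtonPath g (x, p, 0)
      (ContinuousMap.const I x + primitive E (ContinuousMap.const I p)) := by
  simp [IsNewtonPath, momentum]

/-- Near `ε = 0` the solution of Newton's equation is a smooth function of the parameters. -/
theorem exists_local_newtonPath [CompleteSpace E] (hg : ContDiff ℝ ∞ g) (n : ℕ) (x p : E) :
    ∃ ψ : E × E × ℝ → C(I, E), ∀ᶠ z in 𝓝 (x, p, (0 : ℝ)),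
      ContDiffAt ℝ n ψ z ∧ IsNewtonPath g z (ψ z) := by
  set u : (E × E × ℝ) × C(I, E) :=
    ((x, p, 0), ContinuousMap.const I x + primitive E (ContinuousMap.const I p)) with hu
  have hu0 : newtonDefect g u = 0 := isNewtonPath_iff.1 (isNewtonPath_free x p)
  -- One extra order keeps the smoothness exponent nonzero even for `n = 0`.
  have hc : ContDiffAt ℝ (n + 1 : ℕ) (newtonDefect g) u :=
    (contDiff_infty.1 (contDiff_newtonDefect hg) (n + 1)).contDiffAt
  have hn : ((n + 1 : ℕ) : WithTop ℕ∞) ≠ 0 := by norm_cast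
  -- At `ε = 0` the force drops out and the defect is `q` minus a fixed path, so its partial
  -- derivative in `q` is the identity.
  have hinv : (fderiv ℝ (newtonDefect g) u ∘L .inr ℝ (E × E × ℝ) C(I, E)).IsInvertible := by
    refine ⟨ContinuousLinearEquiv.refl ℝ _, ?_⟩
    have h1 := (hc.differentiableAt hn).hasFDerivAt
    have h2 := HasFDerivAt.comp u.2 (f := fun q : C(I, E) => (u.1, q)) h1
      (hasFDerivAt_prodMk_right u.1 u.2)
    have h3 : newtonDefect g ∘ (fun q : C(I, E) => (u.1, q)) = fun q =>
        q - (ContinuousMap.const I x + primitive E (ContinuousMap.const I p)) := by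
      funext q
      simp [newtonDefect, momentum, hu, sub_sub]
    rw [h3] at h2
    exact ((hasFDerivAt_id u.2).sub_const _).unique h2
  refine ⟨hc.implicitFunction hn hinv, ?_⟩
  have h1 := hc.eventually_apply_implicitFunction hn hinv
  have h2 := (hc.contDiffAt_implicitFunction hn hinv).eventually (by simp)
  filter_upwards [h1, h2] with z hz1 hz2
  exact ⟨hz2.of_le (by norm_cast; omega), isNewtonPath_iff.2 (hz1.trans hu0)⟩

open Classical in
/-- The solution of Newton's equation with parameters `(x, p, ε)`, and `0` if it does not exist on
the unit interval. -/
noncomputable def newtonPath (g : E → E) (z : E × E × ℝ) : C(I, E) :=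
  if h : ∃ q, IsNewtonPath g z q then h.choose else 0

theorem IsNewtonPath.newtonPath_eq [CompleteSpace E] (hg : ContDiff ℝ 1 g)
    (h : IsNewtonPath g z q) : newtonPath g z = q := by
  have hex : ∃ q, IsNewtonPath g z q := ⟨q, h⟩
  rw [newtonPath, dif_pos hex]
  exact hex.choose_spec.unique hg h

theorem newtonPath_free [CompleteSpace E] (hg : ContDiff ℝ 1 g) (x p : E) :
    newtonPath g (x, p, 0) =
      ContinuousMap.const I x + primitive E (ContinuousMap.const I p) :=
  (isNewtonPath_free x p).newtonPath_eq hg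

/-- Uniqueness of solutions identifies the chosen path with the local implicit function on a whole
neighbourhood, so it inherits the smoothness. -/
theorem eventually_newtonPath [CompleteSpace E] (hg : ContDiff ℝ ∞ g) (n : ℕ) (x p : E) :
    ∀ᶠ z in 𝓝 (x, p, (0 : ℝ)),
      ContDiffAt ℝ n (newtonPath g) z ∧ IsNewtonPath g z (newtonPath g z) := by
  obtain ⟨ψ, hψ⟩ := exists_local_newtonPath hg n x p
  have hg1 : ContDiff ℝ 1 g := hg.of_le (by simp)
  filter_upwards [hψ.eventually_nhds] with z hz
  have h1 : newtonPath g =ᶠ[𝓝 z] ψ := by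
    filter_upwards [hz] with y hy using hy.2.newtonPath_eq hg1
  refine ⟨hz.self_of_nhds.1.congr_of_eventuallyEq h1, ?_⟩
  rw [h1.self_of_nhds]
  exact hz.self_of_nhds.2

end Newton

/-! ### The Hamiltonian flow, the action and its first variation -/

section Flow

variable {E : Type} [NormedAddCommGroup E] [InnerProductSpace ℝ E] [CompleteSpace E]
  {V : E → ℝ} {x p : E} {ε : ℝ} {q : C(I, E)}

theorem contDiff_gradient (hV : ContDiff ℝ ∞ V) : ContDiff ℝ ∞ (gradient V) :=
  (InnerProductSpace.toDual ℝ E).symm.contDiff.comp (hV.fderiv_right (by simp))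

theorem hamiltonianField_hamiltonian (hV : ContDiff ℝ ∞ V) (ε : ℝ) (z : E × E) :
    hamiltonianField (hamiltonian V ε) z = (z.2, -(ε • gradient V z.1)) := by
  unfold hamiltonianField hamiltonian
  refine Prod.ext ?_ ?_
  · refine HasGradientAt.gradient ?_
    rw [hasGradientAt_iff_hasFDerivAt]
    have h := ((hasStrictFDerivAt_norm_sq z.2).hasFDerivAt.const_mul (1 / 2 : ℝ)).add_const
      (ε * V z.1)
    refine h.congr_fderiv ?_
    ext y
    simp
  · refine congrArg Neg.neg (HasGradientAt.gradient ?_)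
    rw [hasGradientAt_iff_hasFDerivAt]
    have h := ((hV.differentiable (by simp) z.1).hasFDerivAt.const_mul ε).const_add
      (1 / 2 * ‖z.2‖ ^ 2)
    refine h.congr_fderiv ?_
    ext y
    simp

theorem contDiff_newtonField (hV : ContDiff ℝ ∞ V) (ε : ℝ) :
    ContDiff ℝ 1 (fun y : E × E => (y.2, -(ε • gradient V y.1))) := by
  have hg : ContDiff ℝ 1 (gradient V) := (contDiff_gradient hV).of_le (by simp)
  fun_prop

/-- The flow is defined by choosing some integral curve on `[0,t]`; uniqueness makes the choice
agree with the phase curve of `q`. -/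
theorem IsNewtonPath.hamiltonianFlow_eq (hV : ContDiff ℝ ∞ V)
    (h : IsNewtonPath (gradient V) (x, p, ε) q) {t : ℝ} (ht : t ∈ Icc (0 : ℝ) 1) :
    hamiltonianFlow (hamiltonian V ε) t (x, p) = phaseCurve (gradient V) (x, p, ε) q t := by
  have hsub : Icc 0 t ⊆ Icc (0 : ℝ) 1 := Icc_subset_Icc_right ht.2
  have hcurve : IsHamiltonianCurve (hamiltonian V ε) (x, p) t
      (phaseCurve (gradient V) (x, p, ε) q) := by
    refine ⟨h.phaseCurve_zero, fun s hs => ?_⟩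
    rw [uIcc_of_le ht.1] at hs ⊢
    rw [hamiltonianField_hamiltonian hV]
    exact (h.hasDerivWithinAt (contDiff_gradient hV).continuous (hsub hs)).mono hsub
  have hex : ∃ z, IsHamiltonianCurve (hamiltonian V ε) (x, p) t z := ⟨_, hcurve⟩
  rw [hamiltonianFlow, dif_pos hex]
  have hc := hex.choose_spec
  refine eqOn_Icc_of_hasDerivWithinAt (contDiff_newtonField hV ε) (T := t) (fun s hs => ?_)
    (fun s hs => ?_) (hc.1.trans hcurve.1.symm) (right_mem_Icc.2 ht.1)
  · have := hc.2 s (by rwa [uIcc_of_le ht.1])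
    rwa [hamiltonianField_hamiltonian hV, uIcc_of_le ht.1] at this
  · have := hcurve.2 s (by rwa [uIcc_of_le ht.1])
    rwa [hamiltonianField_hamiltonian hV, uIcc_of_le ht.1] at this

theorem IsNewtonPath.flowProj_eq (hV : ContDiff ℝ ∞ V)
    (h : IsNewtonPath (gradient V) (x, p, ε) q) {t : ℝ} (ht : t ∈ Icc (0 : ℝ) 1) :
    flowProj (hamiltonian V ε) t (x, p) = q (projIcc 0 1 zero_le_one t) := by
  rw [flowProj, h.hamiltonianFlow_eq hV ht]
  rfl

theorem IsNewtonPath.flowProj_one (hV : ContDiff ℝ ∞ V)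
    (h : IsNewtonPath (gradient V) (x, p, ε) q) :
    flowProj (hamiltonian V ε) 1 (x, p) = q 1 := by
  rw [h.flowProj_eq hV (right_mem_Icc.2 zero_le_one), projIcc_one_eq]

/-- The action of the solution `q` of Newton's equation with parameters `z = (x, p, ε)`. -/
noncomputable def newtonAction (V : E → ℝ) (z : E × E × ℝ) (q : C(I, E)) : ℝ :=
  primitive ℝ ((1 / 2 : ℝ) • superpose I (fun v : E => ‖v‖ ^ 2) (momentum (gradient V) z q) -
    z.2.2 • superpose I V q) 1

theorem IsNewtonPath.action_eq (hV : ContDiff ℝ ∞ V)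
    (h : IsNewtonPath (gradient V) (x, p, ε) q) :
    action (lagrangian V ε) (fun t => flowProj (hamiltonian V ε) t (x, p)) =
      newtonAction V (x, p, ε) q := by
  unfold action newtonAction
  rw [primitive_apply]
  have hn : Continuous fun v : E => ‖v‖ ^ 2 := by fun_prop
  refine intervalIntegral.integral_congr fun t ht => ?_
  rw [uIcc_of_le zero_le_one] at ht
  have h1 : derivWithin (fun t => flowProj (hamiltonian V ε) t (x, p)) (Icc 0 1) t =
      momentum (gradient V) (x, p, ε) q (projIcc 0 1 zero_le_one t) := by
    have h2 := h.hasDerivWithinAt_position ht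
    have h3 : HasDerivWithinAt (fun t => flowProj (hamiltonian V ε) t (x, p))
        (momentum (gradient V) (x, p, ε) q (projIcc 0 1 zero_le_one t)) (Icc 0 1) t :=
      h2.congr (fun s hs => h.flowProj_eq hV hs) (h.flowProj_eq hV ht)
    exact h3.derivWithin (uniqueDiffOn_Icc zero_lt_one t ht)
  simp only [h1, h.flowProj_eq hV ht, lagrangian]
  simp [superpose_apply hn, superpose_apply hV.continuous]

theorem cost_eq_newtonAction (hV : ContDiff ℝ ∞ V)
    (h : IsNewtonPath (gradient V) (x, p, ε) q)
    (hreg : IsRegularCovector (lagrangian V ε) (hamiltonian V ε) (x, p)) :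
    cost V ε x (q 1) = newtonAction V (x, p, ε) q := by
  obtain ⟨-, ⟨hs, hmin⟩, -⟩ := hreg
  rw [h.flowProj_one hV] at hs hmin
  rw [← h.action_eq hV]
  refine IsLeast.csInf_eq ⟨⟨_, hs, rfl⟩, ?_⟩
  rintro _ ⟨η, hη, rfl⟩
  exact hmin η hη

theorem five_le_infty : (5 : WithTop ℕ∞) ≤ ∞ := 
  WithTop.coe_le_coe.2 (le_top : (5 : ℕ∞) ≤ ⊤)

/-- The parameters near which Newton's equation is solvable, with smooth dependence. -/
def newtonDomain (V : E → ℝ) : Set (E × E × ℝ) :=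
  {z | ∀ᶠ y in 𝓝 z, ContDiffAt ℝ 5 (newtonPath (gradient V)) y ∧
    IsNewtonPath (gradient V) y (newtonPath (gradient V) y)}

theorem isOpen_newtonDomain : IsOpen (newtonDomain V) := isOpen_setOfPred_eventually_nhds

theorem mem_newtonDomain_free (hV : ContDiff ℝ ∞ V) (x p : E) : (x, p, 0) ∈ newtonDomain V :=
  (eventually_newtonPath (contDiff_gradient hV) 5 x p).eventually_nhds.mono
    (fun _ h => h) |>.self_of_nhds

variable {z : E × E × ℝ}

theorem contDiffAt_newtonPath (hz : z ∈ newtonDomain V) :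
    ContDiffAt ℝ 5 (newtonPath (gradient V)) z := hz.self_of_nhds.1

theorem isNewtonPath_newtonPath (hz : z ∈ newtonDomain V) :
    IsNewtonPath (gradient V) z (newtonPath (gradient V) z) := hz.self_of_nhds.2

theorem contDiffAt_newtonAction (hV : ContDiff ℝ ∞ V) (hz : z ∈ newtonDomain V) :
    ContDiffAt ℝ 5 (fun z => newtonAction V z (newtonPath (gradient V) z)) z := by
  have hq := contDiffAt_newtonPath hz
  have hm : ContDiffAt ℝ 5 (fun z => momentum (gradient V) z (newtonPath (gradient V) z)) z :=
    ((contDiff_momentum (contDiff_gradient hV)).of_le five_le_infty).contDiffAt.comp z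
      (contDiffAt_id.prodMk hq)
  have h1 : ContDiffAt ℝ 5 (fun z => superpose I (fun v : E => ‖v‖ ^ 2)
      (momentum (gradient V) z (newtonPath (gradient V) z))) z :=
    ((contDiff_superpose (contDiff_norm_sq ℝ)).of_le five_le_infty).contDiffAt.comp z hm
  have h2 : ContDiffAt ℝ 5 (fun z => superpose I V (newtonPath (gradient V) z)) z :=
    ((contDiff_superpose hV).of_le five_le_infty).contDiffAt.comp z hq
  have h3 : ContDiffAt ℝ 5 (fun z : E × E × ℝ => z.2.2) z := by fun_prop
  exact ((ContinuousMap.evalCLM ℝ (1 : I)).comp (primitive ℝ)).contDiff.contDiffAt.comp z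
    ((h1.const_smul (1 / 2 : ℝ)).sub (h3.smul h2))

/-- The first variation formula, for variations of the initial position and momentum. -/
theorem fderiv_newtonAction (hV : ContDiff ℝ ∞ V) (hz : z ∈ newtonDomain V) (ξ η : E) :
    fderiv ℝ (fun z => newtonAction V z (newtonPath (gradient V) z)) z (ξ, η, 0) =
      ⟪momentum (gradient V) z (newtonPath (gradient V) z) 1,
        fderiv ℝ (newtonPath (gradient V)) z (ξ, η, 0) 1⟫_ℝ - ⟪z.2.1, ξ⟫_ℝ := by
  have hg := contDiff_gradient hV
  have hg1 : ContDiff ℝ 1 (gradient V) := hg.of_le (by simp)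
  set q := newtonPath (gradient V) z with hq
  set P := momentum (gradient V) z q with hP
  set δq := fderiv ℝ (newtonPath (gradient V)) z (ξ, η, 0) with hδq
  set δP : C(I, E) := ContinuousMap.const I η -
    z.2.2 • primitive E (pointwiseApply I E E (superpose I (fderiv ℝ (gradient V)) q) δq) with hδP
  set ℓ : ℝ → E × E × ℝ := fun s => z + s • (ξ, η, (0 : ℝ)) with hℓ
  have hℓ0 : ℓ 0 = z := by simp [hℓ]
  have hℓd : HasDerivAt ℓ (ξ, η, (0 : ℝ)) 0 := hasDerivAt_line _ _
  have hqd : HasDerivAt (fun s => newtonPath (gradient V) (ℓ s)) δq 0 := by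
    have h1 := ((contDiffAt_newtonPath hz).differentiableAt (by norm_num)).hasFDerivAt
    rw [← hℓ0] at h1
    have := h1.comp_hasDerivAt (0 : ℝ) hℓd
    rwa [hℓ0] at this
  have hconst (a b : E) : HasDerivAt (fun s : ℝ => ContinuousMap.const I (a + s • b))
      (ContinuousMap.const I b) 0 := by
    exact (ContinuousLinearMap.const (R := ℝ) (M := E) I).hasFDerivAt.comp_hasDerivAt (0 : ℝ)
      (hasDerivAt_line a b)
  have hPd : HasDerivAt (fun s => momentum (gradient V) (ℓ s) (newtonPath (gradient V) (ℓ s)))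
      δP 0 := by
    have h1 : HasFDerivAt (superpose I (gradient V)) _ (newtonPath (gradient V) (ℓ 0)) :=
      hasFDerivAt_superpose hg1 _
    have h2 := (primitive E).hasFDerivAt.comp_hasDerivAt (0 : ℝ) (h1.comp_hasDerivAt (0 : ℝ) hqd)
    have h3 := (hconst z.2.1 η).sub (h2.const_smul z.2.2)
    rw [hℓ0] at h3
    refine h3.congr_of_eventuallyEq (Eventually.of_forall fun s => ?_)
    simp [momentum, hℓ, Function.comp_def]
  -- The linearised equation: the integral equation holds along `ℓ` near `s = 0` and may be
  -- differentiated there.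
  have hδ : δq = ContinuousMap.const I ξ + primitive E δP := by
    refine hqd.unique (((hconst z.1 ξ).add
      ((primitive E).hasFDerivAt.comp_hasDerivAt (0 : ℝ) hPd)).congr_of_eventuallyEq ?_)
    have h1 : Tendsto ℓ (𝓝 0) (𝓝 z) := by
      have := hℓd.continuousAt.tendsto
      rwa [hℓ0] at this
    filter_upwards [h1.eventually hz] with s hs
    exact hs.2
  have hn : Continuous fun v : E => ‖v‖ ^ 2 := by fun_prop
  have hn1 : ContDiff ℝ 1 fun v : E => ‖v‖ ^ 2 := contDiff_norm_sq ℝ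
  have hV1 : ContDiff ℝ 1 V := hV.of_le (by simp)
  have had := ((contDiffAt_newtonAction hV hz).differentiableAt (by norm_num)).hasFDerivAt
  rw [← hℓ0] at had
  have h1 := had.comp_hasDerivAt (0 : ℝ) hℓd
  rw [hℓ0] at h1
  have hn2 : HasFDerivAt (superpose I fun v : E => ‖v‖ ^ 2) _
    (momentum (gradient V) (ℓ 0) (newtonPath (gradient V) (ℓ 0))) := hasFDerivAt_superpose hn1 _
  have hV2 : HasFDerivAt (superpose I V) _ (newtonPath (gradient V) (ℓ 0)) :=
    hasFDerivAt_superpose hV1 _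
  have h2 := ((ContinuousMap.evalCLM ℝ (1 : I)).comp (primitive ℝ)).hasFDerivAt.comp_hasDerivAt
    (0 : ℝ) (((hn2.comp_hasDerivAt (0 : ℝ) hPd).const_smul (1 / 2 : ℝ)).sub
      ((hV2.comp_hasDerivAt (0 : ℝ) hqd).const_smul z.2.2))
  have h3 := h1.unique (h2.congr_of_eventuallyEq (Eventually.of_forall fun s => by
    simp [newtonAction, hℓ, Function.comp_def]))
  rw [h3, hℓ0]
  -- Integration by parts: `R` vanishes at `0`, and by `P' = -ε ∇V(q)` and `δq' = δP` its derivative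
  -- is the varied integrand `⟨P, δP⟩ - ε dV(δq)`.
  set R : C(I, ℝ) := ⟨fun t => ⟪P t, δq t⟫_ℝ - ⟪z.2.1, ξ⟫_ℝ, by fun_prop⟩ with hR
  have hP0 : P 0 = z.2.1 := momentum_apply_zero
  have hδ0 : δq 0 = ξ := by rw [hδ]; simp
  have key := eq_primitive_of_hasDerivWithinAt (f := R)
    (g := (1 / 2 : ℝ) • pointwiseApply I E ℝ
      (superpose I (fderiv ℝ fun v : E => ‖v‖ ^ 2) P) δP -
      z.2.2 • pointwiseApply I E ℝ (superpose I (fderiv ℝ V) q) δq)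
    (by simp [hR, hP0, hδ0]) (fun t ht => by
      have d1 := hasDerivWithinAt_momentum hg.continuous z q ht
      have d2 := (hasDerivWithinAt_primitive δP ht).const_add ξ
      have d3 : (fun s => δq (projIcc 0 1 zero_le_one s)) =
          fun s => ξ + primitive E δP (projIcc 0 1 zero_le_one s) := by
        funext s
        exact congrArg (fun f => f (projIcc 0 1 zero_le_one s)) hδ
      rw [← d3] at d2
      have d4 := (d1.inner ℝ d2).sub_const ⟪z.2.1, ξ⟫_ℝ
      refine d4.congr_deriv ?_
      simp [superpose_apply (hn1.continuous_fderiv (by norm_num)),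
        superpose_apply (hV1.continuous_fderiv (by norm_num)), 
        inner_smul_left, ← hP]
      ring)
  have := congrArg (fun f => f 1) key
  exact this.symm

end Flow

/-! ### Extracting the factor `ε`: the endpoint map and the operator `M` -/

section Expansion

variable {E : Type} [NormedAddCommGroup E] [InnerProductSpace ℝ E]
  {V : E → ℝ} {x p : E} {ε : ℝ} {z : E × E × ℝ}

variable (E) in
/-- Variations of the initial position. -/
def varPos : E →L[ℝ] E × E × ℝ := .inl ℝ E (E × ℝ)

variable (E) in
/-- Variations of the initial momentum. -/
def varMom : E →L[ℝ] E × E × ℝ := .inr ℝ E (E × ℝ) ∘L .inl ℝ E ℝ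

@[simp] theorem varPos_apply (ξ : E) : varPos E ξ = (ξ, 0, 0) := rfl

@[simp] theorem varMom_apply (η : E) : varMom E η = (0, η, 0) := rfl

/-- The inclusion of initial conditions into the space of parameters. -/
theorem hasFDerivAt_parameters (ε : ℝ) (y : E × E) :
    HasFDerivAt (fun y : E × E => (y.1, y.2, ε))
      ((ContinuousLinearMap.fst ℝ E E).prod ((ContinuousLinearMap.snd ℝ E E).prod 0)) y :=
  hasFDerivAt_fst.prodMk (hasFDerivAt_snd.prodMk (hasFDerivAt_const ε y))

variable [CompleteSpace E]

/-- The twofold primitive of the force at time `1`. -/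
noncomputable def kick (V : E → ℝ) (z : E × E × ℝ) : E :=
  primitive E (primitive E (superpose I (gradient V) (newtonPath (gradient V) z))) 1

theorem newtonPath_apply_one (hz : z ∈ newtonDomain V) :
    newtonPath (gradient V) z 1 = z.1 + z.2.1 - z.2.2 • kick V z := by
  have h := congrArg (fun f => f 1) (isNewtonPath_newtonPath hz)
  simp only [momentum, map_sub, map_smul, ContinuousMap.add_apply, ContinuousMap.const_apply,
    ContinuousMap.sub_apply, ContinuousMap.smul_apply, primitive_const] at h
  rw [h, kick]
  simp [add_sub_assoc]

theorem contDiffAt_kick (hV : ContDiff ℝ ∞ V) (hz : z ∈ newtonDomain V) :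
    ContDiffAt ℝ 5 (kick V) z :=
  ((ContinuousMap.evalCLM ℝ (1 : I)).comp
    ((primitive E).comp (primitive E))).contDiff.contDiffAt.comp z
    (((contDiff_superpose (contDiff_gradient hV)).of_le five_le_infty).contDiffAt.comp z
      (contDiffAt_newtonPath hz))

/-- The derivative of the endpoint with respect to the initial momentum. -/
noncomputable def endpointJac (V : E → ℝ) (z : E × E × ℝ) : E →L[ℝ] E :=
  .id ℝ E - z.2.2 • (fderiv ℝ (kick V) z ∘L varMom E)

/-- The operator `M` such that `-1 - ε M` is the derivative of the initial momentum with respect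
to the initial position, with the endpoint kept fixed. -/
noncomputable def shootingOp (V : E → ℝ) (z : E × E × ℝ) : E →L[ℝ] E :=
  (endpointJac V z).inverse ∘L (fderiv ℝ (kick V) z ∘L (varMom E - varPos E))

/-- The parameters near which Newton's equation is solvable, and which are not conjugate. -/
def shootingDomain (V : E → ℝ) : Set (E × E × ℝ) :=
  {z | z ∈ newtonDomain V ∧ (endpointJac V z).IsInvertible}

theorem contDiffAt_fderiv_kick (hV : ContDiff ℝ ∞ V) (hz : z ∈ newtonDomain V) :
    ContDiffAt ℝ 4 (fderiv ℝ (kick V)) z :=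
  (contDiffAt_kick hV hz).fderiv_right (by norm_num)

theorem contDiffAt_endpointJac (hV : ContDiff ℝ ∞ V) (hz : z ∈ newtonDomain V) :
    ContDiffAt ℝ 4 (endpointJac V) z := by
  have h := contDiffAt_fderiv_kick hV hz
  have h2 : ContDiffAt ℝ 4 (fun z : E × E × ℝ => z.2.2) z := by fun_prop
  exact contDiffAt_const.sub (h2.smul (h.clm_comp contDiffAt_const))

theorem contDiffAt_shootingOp (hV : ContDiff ℝ ∞ V) (hz : z ∈ shootingDomain V) :
    ContDiffAt ℝ 4 (shootingOp V) z := by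
  obtain ⟨hz, e, he⟩ := hz
  have h1 : ContDiffAt ℝ 4 ContinuousLinearMap.inverse (endpointJac V z) := by
    rw [← he]; exact contDiffAt_map_inverse e
  exact (h1.comp z (contDiffAt_endpointJac hV hz)).clm_comp
    ((contDiffAt_fderiv_kick hV hz).clm_comp contDiffAt_const)

theorem isOpen_shootingDomain (hV : ContDiff ℝ ∞ V) : IsOpen (shootingDomain V) := by
  rw [isOpen_iff_mem_nhds]
  rintro z ⟨hz, e, he⟩
  have h1 := (contDiffAt_endpointJac hV hz).continuousAt
  have h2 := ContinuousLinearEquiv.nhds e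
  rw [he] at h2
  filter_upwards [isOpen_newtonDomain.mem_nhds hz, h1.eventually h2] with y hy hy2
  exact ⟨hy, hy2⟩

theorem endpointJac_free (x p : E) : endpointJac V (x, p, 0) = .id ℝ E := by
  simp [endpointJac]

theorem mem_shootingDomain_free (hV : ContDiff ℝ ∞ V) (x p : E) :
    (x, p, 0) ∈ shootingDomain V :=
  ⟨mem_newtonDomain_free hV x p, .refl ℝ E, by rw [endpointJac_free]; rfl⟩

/-- The endpoint of the solution of Newton's equation. -/
noncomputable def newtonEndpoint (V : E → ℝ) (ε : ℝ) (y : E × E) : E :=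
  newtonPath (gradient V) (y.1, y.2, ε) 1

theorem contDiffAt_newtonEndpoint {y : E × E} (hz : (y.1, y.2, ε) ∈ newtonDomain V) :
    ContDiffAt ℝ 5 (newtonEndpoint V ε) y := by
  have h : ContDiffAt ℝ 5 (fun y : E × E => (y.1, y.2, ε)) y := by fun_prop
  exact (ContinuousMap.evalCLM ℝ (1 : I)).contDiff.contDiffAt.comp y
    (ContDiffAt.comp y (contDiffAt_newtonPath hz) h)

theorem fderiv_newtonEndpoint {y : E × E} (hz : (y.1, y.2, ε) ∈ newtonDomain V) (ξ η : E) :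
    fderiv ℝ (newtonEndpoint V ε) y (ξ, η) =
      fderiv ℝ (newtonPath (gradient V)) (y.1, y.2, ε) (ξ, η, 0) 1 := by
  have h1 := ((contDiffAt_newtonPath hz).differentiableAt (by norm_num)).hasFDerivAt
  have h2 := HasFDerivAt.comp y h1 (hasFDerivAt_parameters ε y)
  have h3 := (ContinuousMap.evalCLM ℝ (1 : I)).hasFDerivAt.comp y h2
  have h4 : HasFDerivAt (newtonEndpoint V ε) _ y := h3
  rw [h4.fderiv]
  simp

theorem fderiv_newtonEndpoint_eq (hV : ContDiff ℝ ∞ V) {y : E × E}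
    (hz : (y.1, y.2, ε) ∈ newtonDomain V) (ξ η : E) :
    fderiv ℝ (newtonEndpoint V ε) y (ξ, η) =
      ξ + η - ε • fderiv ℝ (kick V) (y.1, y.2, ε) (ξ, η, 0) := by
  have h1 := ((contDiffAt_kick hV hz).differentiableAt (by norm_num)).hasFDerivAt
  have h2 := HasFDerivAt.comp y h1 (hasFDerivAt_parameters ε y)
  have h3 := (hasFDerivAt_fst (𝕜 := ℝ) (p := y)).add (hasFDerivAt_snd (𝕜 := ℝ) (p := y)) |>.sub
    (h2.const_smul ε)
  have h4 : newtonEndpoint V ε =ᶠ[𝓝 y] fun y => y.1 + y.2 - ε • kick V (y.1, y.2, ε) := by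
    have hc : ContinuousAt (fun y : E × E => (y.1, y.2, ε)) y :=
      (hasFDerivAt_parameters ε y).continuousAt
    filter_upwards [hc.eventually (isOpen_newtonDomain.mem_nhds hz)] with w hw
    exact newtonPath_apply_one hw
  have h5 := h3.congr_of_eventuallyEq h4
  rw [h5.fderiv]
  simp

theorem fderiv_newtonEndpoint_comp_inr (hV : ContDiff ℝ ∞ V) {y : E × E}
    (hz : (y.1, y.2, ε) ∈ newtonDomain V) :
    fderiv ℝ (newtonEndpoint V ε) y ∘L .inr ℝ E E = endpointJac V (y.1, y.2, ε) := by
  ext η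
  simp [fderiv_newtonEndpoint_eq hV hz, endpointJac]

/-- For nonconjugate regular initial conditions the cost `c_ε` is generated by Newton's
equation. -/
theorem isGenerating_cost (hV : ContDiff ℝ ∞ V) {W : Set (E × E)} (hW : IsOpen W)
    (hdom : ∀ y ∈ W, (y.1, y.2, ε) ∈ shootingDomain V)
    (hreg : ∀ y ∈ W, IsRegularCovector (lagrangian V ε) (hamiltonian V ε) y) :
    IsGenerating (cost V ε) W (newtonEndpoint V ε)
      (fun y => newtonAction V (y.1, y.2, ε) (newtonPath (gradient V) (y.1, y.2, ε)))
      (fun y => momentum (gradient V) (y.1, y.2, ε)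
        (newtonPath (gradient V) (y.1, y.2, ε)) 1) where
  isOpen := hW
  contDiffAt y hy := (contDiffAt_newtonEndpoint (hdom y hy).1).of_le (by norm_num)
  contDiffAt_action y hy := by
    have h : ContDiffAt ℝ 5 (fun y : E × E => (y.1, y.2, ε)) y := by fun_prop
    exact (ContDiffAt.comp y (contDiffAt_newtonAction hV (hdom y hy).1) h).of_le (by norm_num)
  isInvertible y hy := by
    rw [fderiv_newtonEndpoint_comp_inr hV (hdom y hy).1]
    exact (hdom y hy).2
  cost_eq y hy := cost_eq_newtonAction hV (isNewtonPath_newtonPath (hdom y hy).1) (hreg y hy)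
  fderiv_action y hy ξ η := by
    have hz := (hdom y hy).1
    have h1 := ((contDiffAt_newtonAction hV hz).differentiableAt (by norm_num)).hasFDerivAt
    have h2 := HasFDerivAt.comp y h1 (hasFDerivAt_parameters ε y)
    have h3 := congrArg (fun f => f (ξ, η)) h2.fderiv
    refine h3.trans ?_
    rw [fderiv_newtonEndpoint hz]
    simpa using fderiv_newtonAction hV hz ξ η

theorem targetSet_eq (hV : ContDiff ℝ ∞ V) {W : Set (E × E)}
    (hdom : ∀ y ∈ W, (y.1, y.2, ε) ∈ shootingDomain V) :
    targetSet V ε W = endpoints (newtonEndpoint V ε) '' W := by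
  refine image_congr fun y hy => ?_
  have := (isNewtonPath_newtonPath (hdom y hy).1).flowProj_one hV
  exact Prod.ext rfl this

/-- Moving the initial position by `u` and the momentum by `-(u + ε M u)` keeps the endpoint. -/
theorem fderiv_newtonEndpoint_shooting (hV : ContDiff ℝ ∞ V) {y : E × E}
    (hz : (y.1, y.2, ε) ∈ shootingDomain V) (u : E) :
    fderiv ℝ (newtonEndpoint V ε) y
      (u, -(u + ε • shootingOp V (y.1, y.2, ε) u)) = 0 := by
  rw [fderiv_newtonEndpoint_eq hV hz.1]
  obtain ⟨hz, e, he⟩ := hz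
  set k := fderiv ℝ (kick V) (y.1, y.2, ε) with hk
  set m := shootingOp V (y.1, y.2, ε) u with hm
  -- The defining equation of `m = M u`; it is what remains, after division by `-ε`, of the
  -- requirement that the endpoint be stationary.
  have h1 : m - ε • k (0, m, 0) = k (0, u, 0) - k (u, 0, 0) := by
    have h2 : endpointJac V (y.1, y.2, ε) m = k (0, u, 0) - k (u, 0, 0) := by
      rw [hm, shootingOp, ← he, ContinuousLinearMap.inverse_equiv]
      simp [← hk]
    rw [← h2]
    simp [endpointJac, ← hk]
  have h3 : k (u, -(u + ε • m), 0) = k (u, 0, 0) - k (0, u, 0) - ε • k (0, m, 0) := by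
    have h4 : (u, -(u + ε • m), (0 : ℝ)) = (u, 0, 0) - (0, u, 0) - ε • (0, m, 0) := by
      ext <;> simp
      abel
    rw [h4, map_sub, map_sub, map_smul]
  have h4 : k (u, 0, 0) = k (0, u, 0) - m + ε • k (0, m, 0) := by
    rw [eq_sub_iff_add_eq] at h1
    rw [← h1]; abel
  rw [h3, h4]
  module

/-- The second derivative in the momentum direction `w` of the quadratic form of `M` at `u`. -/
noncomputable def shootingCurvature (V : E → ℝ) (z : E × E × ℝ) (u w : E) : ℝ :=
  ⟪fderiv ℝ (fderiv ℝ (shootingOp V)) z (varMom E w) (varMom E w) u, u⟫_ℝ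

theorem continuousAt_shootingCurvature (hV : ContDiff ℝ ∞ V) (hz : z ∈ shootingDomain V)
    (u w : E) :
    ContinuousAt (fun a : (E × E × ℝ) × E × E => shootingCurvature V a.1 a.2.1 a.2.2)
      (z, u, w) := by
  have h1 : ContDiffAt ℝ 3 (fderiv ℝ (shootingOp V)) z :=
    (contDiffAt_shootingOp hV hz).fderiv_right (by norm_num)
  have h2 : ContinuousAt (fderiv ℝ (fderiv ℝ (shootingOp V))) z :=
    (h1.fderiv_right (m := 2) (by norm_num)).continuousAt
  have h3 : ContinuousAt (fun a : (E × E × ℝ) × E × E =>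
      fderiv ℝ (fderiv ℝ (shootingOp V)) a.1) (z, u, w) :=
    ContinuousAt.comp (f := Prod.fst) h2 continuousAt_fst
  have h4 : ContinuousAt (fun a : (E × E × ℝ) × E × E => varMom E a.2.2) (z, u, w) := by
    fun_prop
  have h5 : ContinuousAt (fun a : (E × E × ℝ) × E × E => a.2.1) (z, u, w) := by fun_prop
  exact (((h3.clm_apply h4).clm_apply h4).clm_apply h5).inner (𝕜 := ℝ) h5

theorem shootingCurvature_smul (a b : ℝ) (u w : E) :
    shootingCurvature V z (a • u) (b • w) = a ^ 2 * b ^ 2 * shootingCurvature V z u w := by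
  simp only [shootingCurvature, map_smul, smul_apply, inner_smul_left,
    inner_smul_right]
  simp
  ring

theorem hasDerivAt_comp_of_differentiableAt {G H : Type*} [NormedAddCommGroup G]
    [NormedSpace ℝ G] [NormedAddCommGroup H] [NormedSpace ℝ H] {f : G → H} {ℓ : ℝ → G} {v : G}
    {t : ℝ} (hf : DifferentiableAt ℝ f (ℓ t)) (hℓ : HasDerivAt ℓ v t) :
    HasDerivAt (fun s => f (ℓ s)) (fderiv ℝ f (ℓ t) v) t :=
  hf.hasFDerivAt.comp_hasDerivAt t hℓ

/-- The form `⟪u + r M u, u⟫` along a momentum line. -/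
theorem shootingForm_line (hV : ContDiff ℝ ∞ V) (hz : (x, p, ε) ∈ shootingDomain V) (r : ℝ)
    (u w : E) :
    ContDiffAt ℝ 2 (fun s : ℝ => ⟪u + r • shootingOp V (x, p + s • w, ε) u, u⟫_ℝ) 0 ∧
      iteratedDeriv 2 (fun s : ℝ => ⟪u + r • shootingOp V (x, p + s • w, ε) u, u⟫_ℝ) 0 =
        r * shootingCurvature V (x, p, ε) u w := by
  have hline : ∀ s : ℝ, (x, p + s • w, ε) = (x, p, ε) + s • varMom E w := fun s => by simp
  simp only [hline]
  set z := (x, p, ε)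
  set ℓ : ℝ → E × E × ℝ := fun s => z + s • varMom E w with hℓ
  have hℓc : ContDiff ℝ 2 ℓ := by fun_prop
  have hℓ0 : ℓ 0 = z := by simp [hℓ]
  have hℓd : ∀ s, HasDerivAt ℓ (varMom E w) s := fun s => by
    simpa only [one_smul, id] using ((hasDerivAt_id s).smul_const (varMom E w)).const_add z
  have hC : ContDiffAt ℝ 4 (shootingOp V) z := contDiffAt_shootingOp hV hz
  refine ⟨?_, ?_⟩
  · have h0 : ContDiffAt ℝ 2 (shootingOp V) (ℓ 0) := by
      rw [hℓ0]; exact hC.of_le (by norm_num)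
    have h1 : ContDiffAt ℝ 2 (fun s => shootingOp V (ℓ s)) 0 := h0.comp (0 : ℝ) hℓc.contDiffAt
    exact (contDiffAt_const.add ((h1.clm_apply contDiffAt_const).const_smul r)).inner ℝ
      contDiffAt_const
  · have hev : ∀ᶠ s in 𝓝 (0 : ℝ), DifferentiableAt ℝ (shootingOp V) (ℓ s) := by
      have h1 : ∀ᶠ y in 𝓝 (ℓ 0), DifferentiableAt ℝ (shootingOp V) y := by
        rw [hℓ0]
        filter_upwards [(isOpen_shootingDomain hV).mem_nhds hz] with y hy
        exact (contDiffAt_shootingOp hV hy).differentiableAt (by norm_num)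
      exact hℓc.continuous.continuousAt.eventually h1
    have hd : deriv (fun s : ℝ => ⟪u + r • shootingOp V (ℓ s) u, u⟫_ℝ) =ᶠ[𝓝 0]
        fun s => ⟪r • fderiv ℝ (shootingOp V) (ℓ s) (varMom E w) u, u⟫_ℝ := by
      filter_upwards [hev] with s hs
      have h1 := hs.hasFDerivAt.comp_hasDerivAt s (hℓd s)
      have h2 := (((h1.clm_apply (hasDerivAt_const s u)).const_smul r).const_add u).inner ℝ
        (hasDerivAt_const s u)
      refine h2.deriv.trans ?_
      simp
    rw [iteratedDeriv_succ, iteratedDeriv_one, hd.deriv_eq]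
    have h1 : DifferentiableAt ℝ (fderiv ℝ (shootingOp V)) (ℓ 0) := by
      rw [hℓ0]
      exact (hC.fderiv_right (m := 3) (by norm_num)).differentiableAt (by norm_num)
    have h2 := hasDerivAt_comp_of_differentiableAt (H := (E × E × ℝ) →L[ℝ] E →L[ℝ] E)
      (f := fderiv ℝ (shootingOp V)) h1 (hℓd 0)
    rw [hℓ0] at h2
    have h3 := (((h2.clm_apply (hasDerivAt_const 0 (varMom E w))).clm_apply
      (hasDerivAt_const 0 u)).const_smul r).inner ℝ (hasDerivAt_const 0 u)
    refine h3.deriv.trans ?_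
    simp [shootingCurvature, inner_smul_left]

end Expansion

/-! ### The limit `ε = 0`, the compactness argument and the sign of the cross-curvature -/

section Limit

theorem iteratedDeriv_two_clm_comp {F G : Type*} [NormedAddCommGroup F] [NormedSpace ℝ F]
    [NormedAddCommGroup G] [NormedSpace ℝ G] (L : F →L[ℝ] G) {h : ℝ → F} (hh : ContDiff ℝ 2 h)
    (s : ℝ) : iteratedDeriv 2 (fun s => L (h s)) s = L (iteratedDeriv 2 h s) := by
  have h1 : deriv (fun s => L (h s)) = fun s => L (deriv h s) := by
    funext s
    exact (L.hasFDerivAt.comp_hasDerivAt s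
      (hh.differentiable (by norm_num) s).hasDerivAt).deriv
  have h2 : Differentiable ℝ (deriv h) :=
    (hh.deriv' (n := 1)).differentiable (by norm_num)
  rw [iteratedDeriv_succ, iteratedDeriv_one, h1, iteratedDeriv_succ, iteratedDeriv_one]
  exact (L.hasFDerivAt.comp_hasDerivAt s (h2 s).hasDerivAt).deriv

variable {E : Type} [NormedAddCommGroup E] [InnerProductSpace ℝ E]

theorem norm_inv_norm_smul {u : E} (hu : u ≠ 0) : ‖‖u‖⁻¹ • u‖ = 1 := by
  rw [norm_smul, norm_inv, norm_norm, inv_mul_cancel₀ (norm_ne_zero_iff.2 hu)]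

/-- The straight line `t ↦ x + t p`. -/
noncomputable def freePath (x p : E) : C(I, E) :=
  ContinuousMap.const I x + primitive E (ContinuousMap.const I p)

/-- The functional `A ↦ ∫₀¹ ∫₀^τ (t - 1) ⟪u, A(t) u⟫ dt dτ`. -/
noncomputable def weightedForm (u : E) : C(I, E →L[ℝ] E) →L[ℝ] ℝ :=
  ContinuousMap.evalCLM ℝ (1 : I) ∘L primitive ℝ ∘L primitive ℝ ∘L
    pointwiseApply I (E →L[ℝ] E) ℝ
      ⟨fun t => ((t : ℝ) - 1) • (innerSL ℝ u ∘L ContinuousLinearMap.apply ℝ E u), by fun_prop⟩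

theorem weightedForm_apply (A : C(I, E →L[ℝ] E)) (u : E) :
    weightedForm u A = ∫ τ in (0 : ℝ)..1, ∫ t in (0 : ℝ)..τ,
      -⟪u, (1 - t) • A (projIcc 0 1 zero_le_one t) u⟫_ℝ := by
  simp only [weightedForm, ContinuousLinearMap.comp_apply, ContinuousMap.evalCLM_apply]
  rw [primitive_apply, Icc.coe_one]
  refine intervalIntegral.integral_congr fun τ hτ => ?_
  rw [uIcc_of_le zero_le_one] at hτ
  rw [primitive_apply, projIcc_of_mem zero_le_one hτ]
  refine intervalIntegral.integral_congr fun t ht => ?_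
  rw [uIcc_of_le hτ.1] at ht
  have ht' : t ∈ Icc (0 : ℝ) 1 := ⟨ht.1, ht.2.trans hτ.2⟩
  simp [inner_smul_right, projIcc_of_mem zero_le_one ht']
  ring

variable [CompleteSpace E] {V : E → ℝ}

theorem freePath_apply (x p : E) (t : I) : freePath x p t = x + (t : ℝ) • p := by
  simp [freePath, primitive_const]

/-- The weight `t - 1` comes from the variation `freePath (-u) u`, whose value at `t` is `(t - 1)
u`: the free Jacobi field that starts at `-u` and ends at `0`. -/
theorem weightedForm_eq_inner (A : C(I, E →L[ℝ] E)) (u : E) :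
    weightedForm u A =
      ⟪primitive E (primitive E (pointwiseApply I E E A (freePath (-u) u))) 1, u⟫_ℝ := by
  have h1 := primitive_comp_clm (innerSL ℝ u)
    (primitive E (pointwiseApply I E E A (freePath (-u) u)))
  rw [← primitive_comp_clm] at h1
  have h2 := congrArg (fun f => f 1) h1
  rw [real_inner_comm]
  refine Eq.trans ?_ h2
  simp only [weightedForm, ContinuousLinearMap.comp_apply, ContinuousMap.evalCLM_apply]
  congr 3
  ext t
  simp [freePath_apply, inner_add_right, inner_smul_right]
  ring

theorem continuous_hess (hV : ContDiff ℝ ∞ V) : Continuous (hess V) :=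
  (contDiff_gradient hV).continuous_fderiv (by simp)

theorem contDiff_hess (hV : ContDiff ℝ ∞ V) : ContDiff ℝ ∞ (hess V) :=
  (contDiff_gradient hV).fderiv_right (by simp)

/-- With `ε` held at `0` the solution is the straight line, which is linear in the initial data, so
only the gradient is differentiated. -/
theorem fderiv_kick_free (hV : ContDiff ℝ ∞ V) (x p ξ η : E) :
    fderiv ℝ (kick V) (x, p, 0) (ξ, η, 0) =
      primitive E (primitive E (pointwiseApply I E E (superpose I (hess V) (freePath x p))
        (freePath ξ η))) 1 := by
  have hg1 : ContDiff ℝ 1 (gradient V) := (contDiff_gradient hV).of_le (by simp)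
  have h1 := ((contDiffAt_kick hV (mem_newtonDomain_free hV x p)).differentiableAt
    (by norm_num)).hasFDerivAt
  have h2 := hasDerivAt_line (x, p, (0 : ℝ)) (ξ, η, (0 : ℝ))
  have h0 : (x, p, (0 : ℝ)) = (x, p, (0 : ℝ)) + (0 : ℝ) • (ξ, η, (0 : ℝ)) := by simp
  have h3 := h1.comp_hasDerivAt_of_eq (0 : ℝ) h2 h0
  have h4 : HasDerivAt (fun s : ℝ => freePath x p + s • freePath ξ η) (freePath ξ η) 0 :=
    hasDerivAt_line _ _
  have h5 : HasFDerivAt (superpose I (gradient V)) _ (freePath x p + (0 : ℝ) • freePath ξ η) :=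
    hasFDerivAt_superpose hg1 _
  have h6 := ((ContinuousMap.evalCLM ℝ (1 : I)).comp
    ((primitive E).comp (primitive E))).hasFDerivAt.comp_hasDerivAt (0 : ℝ)
      (h5.comp_hasDerivAt (0 : ℝ) h4)
  refine (h3.unique (h6.congr_of_eventuallyEq (Eventually.of_forall fun s => ?_))).trans ?_
  · have h7 : newtonPath (gradient V) ((x, p, (0 : ℝ)) + s • (ξ, η, (0 : ℝ))) =
        freePath x p + s • freePath ξ η := by
      have h8 : (x, p, (0 : ℝ)) + s • (ξ, η, (0 : ℝ)) = (x + s • ξ, p + s • η, 0) := by simp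
      rw [h8, newtonPath_free hg1]
      ext t
      simp [freePath_apply, primitive_const, smul_smul, mul_comm]
      abel
    simp only [Function.comp_apply, kick]
    rw [h7]
    rfl
  · simp only [zero_smul, add_zero]
    rfl

theorem shootingOp_free (hV : ContDiff ℝ ∞ V) (x p u : E) :
    ⟪shootingOp V (x, p, 0) u, u⟫_ℝ =
      weightedForm u (superpose I (hess V) (freePath x p)) := by
  rw [weightedForm_eq_inner, ← fderiv_kick_free hV]
  have h1 : (endpointJac V (x, p, 0)).inverse = .id ℝ E := by
    rw [endpointJac_free]; exact ContinuousLinearMap.inverse_id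
  simp only [shootingOp, h1, ContinuousLinearMap.comp_apply, ContinuousLinearMap.id_apply,
    sub_apply]
  simp

/-- Differentiation in `s` passes under the double integral because `weightedForm u` is a continuous
linear functional and the Hessian along the line is a smooth curve in the space of continuous maps.
-/
theorem shootingCurvature_free (hV : ContDiff ℝ ∞ V) (x p u w : E) :
    shootingCurvature V (x, p, 0) u w = -perturbIntegral V x p u w := by
  set H : ℝ → C(I, E →L[ℝ] E) := fun s => superpose I (hess V) (freePath x (p + s • w)) with hH
  have hline : ∀ s : ℝ, freePath x (p + s • w) = freePath x p + s • freePath 0 w := fun s => by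
    ext t
    simp [freePath_apply, smul_smul, mul_comm, add_assoc]
  have hHc : ContDiff ℝ 2 H := by
    have h1 : ContDiff ℝ 2 (fun s : ℝ => freePath x (p + s • w)) := by
      simp only [hline]; fun_prop
    have h2 : (2 : WithTop ℕ∞) ≤ ∞ := WithTop.coe_le_coe.2 (le_top : (2 : ℕ∞) ≤ ⊤)
    exact ((contDiff_superpose (contDiff_hess hV)).of_le h2).comp h1
  -- The coefficient is `1` although `ε = 0`: coefficient `ε` would erase the operator.
  have h1 := (shootingForm_line hV (mem_shootingDomain_free hV x p) 1 u w).2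
  have h2 : (fun s : ℝ => ⟪u + (1 : ℝ) • shootingOp V (x, p + s • w, 0) u, u⟫_ℝ) =
      fun s => ⟪u, u⟫_ℝ + weightedForm u (H s) := by
    funext s
    rw [one_smul, inner_add_left, shootingOp_free hV]
  have h3 : iteratedDeriv 2 (fun s => ⟪u, u⟫_ℝ + weightedForm u (H s)) 0 =
      iteratedDeriv 2 (fun s => weightedForm u (H s)) 0 := by
    simp only [iteratedDeriv_succ, iteratedDeriv_zero]
    congr 1
    funext s
    exact deriv_const_add _
  rw [h2, h3, iteratedDeriv_two_clm_comp _ hHc, one_mul] at h1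
  rw [← h1, weightedForm_apply, perturbIntegral, ← intervalIntegral.integral_neg]
  refine intervalIntegral.integral_congr fun τ hτ => ?_
  rw [uIcc_of_le zero_le_one] at hτ
  rw [← intervalIntegral.integral_neg]
  refine intervalIntegral.integral_congr fun t ht => ?_
  rw [uIcc_of_le hτ.1] at ht
  have ht' : t ∈ Icc (0 : ℝ) 1 := ⟨ht.1, ht.2.trans hτ.2⟩
  have h4 := iteratedDeriv_two_clm_comp
    (ContinuousMap.evalCLM ℝ (projIcc (0 : ℝ) 1 zero_le_one t)) hHc 0
  have h5 : (fun s => ContinuousMap.evalCLM ℝ (projIcc (0 : ℝ) 1 zero_le_one t) (H s)) =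
      fun s : ℝ => hess V (x + t • (p + s • w)) := by
    funext s
    simp only [ContinuousMap.evalCLM_apply, hH]
    rw [superpose_apply (continuous_hess hV), freePath_apply, projIcc_of_mem zero_le_one ht']
  rw [h5] at h4
  simp only [h4, ContinuousMap.evalCLM_apply, smul_apply]

/-- For small `ε` the curvature form is negative wherever the perturbation integral is bounded
below by a positive constant. -/
theorem exists_shootingCurvature_neg [ProperSpace E] (hV : ContDiff ℝ ∞ V) {U : Set (E × E)}
    (hU : Bornology.IsBounded U) {C : ℝ} (hC : 0 < C) :
    ∃ ε₀ : ℝ, 0 < ε₀ ∧ ∀ ε : ℝ, 0 < ε → ε < ε₀ → ∀ y ∈ U, (y.1, y.2, ε) ∈ shootingDomain V ∧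
      ∀ u w : E, ‖u‖ = 1 → ‖w‖ = 1 → C ≤ perturbIntegral V y.1 y.2 u w →
        shootingCurvature V (y.1, y.2, ε) u w < 0 := by
  have hK : IsCompact (closure U) := hU.isCompact_closure
  have hS : IsCompact (Metric.sphere (0 : E) 1) := isCompact_sphere _ _
  have h1 : ∀ᶠ ε in 𝓝 (0 : ℝ), ∀ y ∈ closure U, (y.1, y.2, ε) ∈ shootingDomain V := by
    refine hK.eventually_forall_of_forall_eventually fun y _ => ?_
    have hc : ContinuousAt (fun a : ℝ × E × E => (a.2.1, a.2.2, a.1)) (0, y) := by fun_prop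
    exact hc.eventually ((isOpen_shootingDomain hV).mem_nhds (mem_shootingDomain_free hV y.1 y.2))
  have h2 : ∀ᶠ ε in 𝓝 (0 : ℝ), ∀ a ∈ closure U ×ˢ (Metric.sphere (0 : E) 1 ×ˢ
      Metric.sphere (0 : E) 1), shootingCurvature V (a.1.1, a.1.2, ε) a.2.1 a.2.2 <
        shootingCurvature V (a.1.1, a.1.2, 0) a.2.1 a.2.2 + C := by
    refine (hK.prod (hS.prod hS)).eventually_forall_of_forall_eventually fun a _ => ?_
    -- Used for the curvature at `ε` and for the curvature at `0`. The two are compared on the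
    -- closure of `U`, while the lower bound `C` is needed only at points of `U`.
    have hc (f : ℝ × (E × E) × E × E → ℝ) (hf : Continuous f) (h0 : f (0, a) = 0) :
        ContinuousAt (fun b : ℝ × (E × E) × E × E =>
          shootingCurvature V (b.2.1.1, b.2.1.2, f b) b.2.2.1 b.2.2.2) (0, a) := by
      have h3 : ContinuousAt (fun a : (E × E × ℝ) × E × E =>
          shootingCurvature V a.1 a.2.1 a.2.2) ((a.1.1, a.1.2, f (0, a)), a.2.1, a.2.2) := by
        rw [h0]
        exact continuousAt_shootingCurvature hV (mem_shootingDomain_free hV a.1.1 a.1.2) _ _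
      have h4 : ContinuousAt (fun b : ℝ × (E × E) × E × E =>
          ((b.2.1.1, b.2.1.2, f b), b.2.2.1, b.2.2.2)) (0, a) := by fun_prop
      exact ContinuousAt.comp (f := fun b : ℝ × (E × E) × E × E =>
          ((b.2.1.1, b.2.1.2, f b), b.2.2.1, b.2.2.2)) h3 h4
    have h5 := hc (fun b => b.1) continuous_fst rfl
    have h6 := (hc (fun _ => 0) continuous_const rfl).add (continuousAt_const (y := C))
    exact h5.eventually_lt h6 (lt_add_of_pos_right _ hC)
  obtain ⟨ε₀, hε₀, h⟩ := Metric.eventually_nhds_iff.1 (h1.and h2)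
  refine ⟨ε₀, hε₀, fun ε hε hεε y hy => ?_⟩
  have hd : dist ε 0 < ε₀ := by rwa [Real.dist_eq, sub_zero, abs_of_pos hε]
  obtain ⟨h3, h4⟩ := h hd
  refine ⟨h3 y (subset_closure hy), fun u w hu hw hCp => ?_⟩
  have h5 := h4 (y, u, w) ⟨subset_closure hy, by simpa using hu, by simpa using hw⟩
  simp only [shootingCurvature_free hV] at h5
  linarith

variable {ε : ℝ} {W : Set (E × E)}

/-- The values of the cross-curvature of `c_ε`. -/
theorem exists_of_isCrossCurvature (hV : ContDiff ℝ ∞ V) (hW : IsOpen W)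
    (hdom : ∀ y ∈ W, (y.1, y.2, ε) ∈ shootingDomain V)
    (hreg : ∀ y ∈ W, IsRegularCovector (lagrangian V ε) (hamiltonian V ε) y)
    {x u : E} {α α₁ : E →L[ℝ] ℝ} {r : ℝ}
    (hα : α ∈ covectors (cost V ε) (targetSet V ε W) x)
    (hr : IsCrossCurvature (cost V ε) (targetSet V ε W) x u α α₁ r) :
    ∃ p w : E, (x, p) ∈ W ∧ α₁ = innerSL ℝ w ∧
      r = -(3 / 2) * (ε * shootingCurvature V (x, p, ε) u w) := by
  have hgen := isGenerating_cost hV hW hdom hreg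
  rw [targetSet_eq hV hdom] at hα hr
  obtain ⟨_, ⟨⟨x', p⟩, hy, he⟩, rfl⟩ := hα
  obtain ⟨rfl, rfl⟩ := Prod.mk.inj he
  obtain ⟨γ, hγ, h0, rfl, rfl⟩ := hr
  set w : E := (InnerProductSpace.toDual ℝ E).symm α₁ with hw
  have hα₁ : α₁ = innerSL ℝ w := by
    ext v
    simp [hw]
  refine ⟨p, w, hy, hα₁, ?_⟩
  have h1 : dx (cost V ε) x' (newtonEndpoint V ε (x', p)) = -innerSL ℝ p := hgen.dx_eq hy
  have hform := shootingForm_line hV (hdom _ hy) ε (deriv γ 0) w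
  simp only
  rw [h1, neg_neg, hα₁, ← hform.2]
  refine hgen.crossCurvatureAlong_eq hy hγ h0 hform.1 ?_
  have hc : ContinuousAt (fun s : ℝ => (x', p + s • w)) 0 := by fun_prop
  have hmem : ∀ᶠ s in 𝓝 (0 : ℝ), (x', p + s • w) ∈ W :=
    hc.eventually (by simpa using hW.mem_nhds hy)
  filter_upwards [hmem] with s hs
  -- The witness is `η = u + ε M u` at the shifted momentum `p + s w`.
  exact ⟨_, fderiv_newtonEndpoint_shooting hV (hdom _ hs) _, rfl⟩

theorem shootingCurvature_neg_of_unit {z : E × E × ℝ} {u w : E} (hu : u ≠ 0) (hw : w ≠ 0)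
    (h : shootingCurvature V z (‖u‖⁻¹ • u) (‖w‖⁻¹ • w) < 0) : shootingCurvature V z u w < 0 := by
  rw [shootingCurvature_smul] at h
  have hu' := norm_pos_iff.2 hu
  have hw' := norm_pos_iff.2 hw
  by_contra hcon
  exact absurd h (not_lt.2 (mul_nonneg (by positivity) (not_lt.1 hcon)))

theorem shootingCurvature_zero_left (z : E × E × ℝ) (w : E) : shootingCurvature V z 0 w = 0 := by
  simp [shootingCurvature]

theorem shootingCurvature_zero_right (z : E × E × ℝ) (u : E) : shootingCurvature V z u 0 = 0 := by
  simp only [shootingCurvature, map_zero, zero_apply, inner_zero_left]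

/-- The sign of the cross-curvature in the directions subject to a relation `R`. -/
theorem crossCurvature_sign (hV : ContDiff ℝ ∞ V) (hε : 0 < ε) (hW : IsOpen W)
    (hdom : ∀ y ∈ W, (y.1, y.2, ε) ∈ shootingDomain V)
    (hreg : ∀ y ∈ W, IsRegularCovector (lagrangian V ε) (hamiltonian V ε) y)
    {R : E → E → Prop} (hR : ∀ (a b : ℝ) (u w : E), R u w → R (a • u) (b • w))
    (hneg : ∀ y ∈ W, ∀ u w : E, ‖u‖ = 1 → ‖w‖ = 1 → R u w →
      shootingCurvature V (y.1, y.2, ε) u w < 0)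
    {x u : E} {α α₁ : E →L[ℝ] ℝ} {r : ℝ}
    (hα : α ∈ covectors (cost V ε) (targetSet V ε W) x)
    (hRα : ∀ w : E, α₁ = innerSL ℝ w → R u w)
    (hr : IsCrossCurvature (cost V ε) (targetSet V ε W) x u α α₁ r) :
    0 ≤ r ∧ (r = 0 → u = 0 ∨ α₁ = 0) := by
  obtain ⟨p, w, hy, rfl, rfl⟩ := exists_of_isCrossCurvature hV hW hdom hreg hα hr
  by_cases hu : u = 0
  · subst hu
    exact ⟨by rw [shootingCurvature_zero_left]; simp, fun _ => Or.inl rfl⟩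
  by_cases hw : w = 0
  · subst hw
    exact ⟨by rw [shootingCurvature_zero_right]; simp, fun _ => Or.inr (map_zero _)⟩
  have h1 : shootingCurvature V (x, p, ε) u w < 0 :=
    shootingCurvature_neg_of_unit hu hw (hneg (x, p) hy _ _ (norm_inv_norm_smul hu)
      (norm_inv_norm_smul hw) (hR _ _ _ _ (hRα w rfl)))
  have h2 : 0 < -(3 / 2) * (ε * shootingCurvature V (x, p, ε) u w) := by
    nlinarith [mul_neg_of_pos_of_neg hε h1]
  exact ⟨h2.le, fun h => absurd h h2.ne'⟩

end Limit

end MTW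

theorem theorem5p1 (n : ℕ) (V : EuclideanSpace ℝ (Fin n) → ℝ)
    (hV : ContDiff ℝ ∞ V) (hVb : BddAbove (range V))
    (Ueps : ℝ → Set (EuclideanSpace ℝ (Fin n) × EuclideanSpace ℝ (Fin n)))
    (hUeps_open : ∀ ε : ℝ, 0 < ε → IsOpen (Ueps ε))
    (hUeps_reg : ∀ ε : ℝ, 0 < ε → ∀ z ∈ Ueps ε,
      MTW.IsRegularCovector (MTW.lagrangian V ε) (MTW.hamiltonian V ε) z ∧
        ¬ MTW.IsConjugate (MTW.hamiltonian V ε) z)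
    (U : Set (EuclideanSpace ℝ (Fin n) × EuclideanSpace ℝ (Fin n)))
    (hU_open : IsOpen U) (hU_bdd : Bornology.IsBounded U)
    (C : ℝ) (hC : 0 < C) :
    ((∀ x v : EuclideanSpace ℝ (Fin n), (x, v) ∈ U →
        ∀ u w : EuclideanSpace ℝ (Fin n), ‖u‖ = 1 → ‖w‖ = 1 →
          C ≤ MTW.perturbIntegral V x v u w) →
      ∃ ε₀ : ℝ, 0 < ε₀ ∧ ∀ ε : ℝ, 0 < ε → ε < ε₀ →
        MTW.SatisfiesA012 (MTW.cost V ε) (MTW.targetSet V ε (Ueps ε ∩ U)) ∧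
        MTW.SatisfiesB3s (MTW.cost V ε) (MTW.targetSet V ε (Ueps ε ∩ U))) ∧
    ((∀ x v : EuclideanSpace ℝ (Fin n), (x, v) ∈ U →
        ∀ u w : EuclideanSpace ℝ (Fin n), ‖u‖ = 1 → ‖w‖ = 1 → ⟪u, w⟫_ℝ = 0 →
          C ≤ MTW.perturbIntegral V x v u w) →
      ∃ ε₀ : ℝ, 0 < ε₀ ∧ ∀ ε : ℝ, 0 < ε → ε < ε₀ →
        MTW.SatisfiesA012 (MTW.cost V ε) (MTW.targetSet V ε (Ueps ε ∩ U)) ∧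
        MTW.SatisfiesA3s (MTW.cost V ε) (MTW.targetSet V ε (Ueps ε ∩ U))) := by
  -- One `ε₀` serves both parts, since the lower bound is required separately for each pair `(u,
  -- w)`.
  obtain ⟨ε₀, hε₀, hcurv⟩ := MTW.exists_shootingCurvature_neg hV hU_bdd hC
  have hopen : ∀ ε : ℝ, 0 < ε → IsOpen (Ueps ε ∩ U) := fun ε hε =>
    (hUeps_open ε hε).inter hU_open
  have hdom : ∀ ε : ℝ, 0 < ε → ε < ε₀ → ∀ y ∈ Ueps ε ∩ U,
      (y.1, y.2, ε) ∈ MTW.shootingDomain V := fun ε hε hεε y hy => (hcurv ε hε hεε y hy.2).1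
  have hreg : ∀ ε : ℝ, 0 < ε → ∀ y ∈ Ueps ε ∩ U,
      MTW.IsRegularCovector (MTW.lagrangian V ε) (MTW.hamiltonian V ε) y := fun ε hε y hy =>
    (hUeps_reg ε hε y hy.1).1
  have hA : ∀ ε : ℝ, 0 < ε → ε < ε₀ →
      MTW.SatisfiesA012 (MTW.cost V ε) (MTW.targetSet V ε (Ueps ε ∩ U)) := fun ε hε hεε => by
    rw [MTW.targetSet_eq hV (hdom ε hε hεε)]
    exact (MTW.isGenerating_cost hV (hopen ε hε) (hdom ε hε hεε) (hreg ε hε)).satisfiesA012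
  refine ⟨fun hpos => ⟨ε₀, hε₀, fun ε hε hεε => ⟨hA ε hε hεε, ?_⟩⟩,
    fun hpos => ⟨ε₀, hε₀, fun ε hε hεε => ⟨hA ε hε hεε, ?_⟩⟩⟩
  -- The relation on directions is trivial here and is orthogonality for (A3s); both survive
  -- rescaling to unit vectors.
  · have key := fun x u α α₁ r hα hr => MTW.crossCurvature_sign (x := x) (u := u) (α := α)
      (α₁ := α₁) (r := r) hV hε (hopen ε hε) (hdom ε hε hεε) (hreg ε hε)
      (R := fun _ _ => True) (fun _ _ _ _ _ => trivial)
      (fun y hy u w hu hw _ => (hcurv ε hε hεε y hy.2).2 u w hu hw (hpos _ _ hy.2 u w hu hw))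
      hα (fun _ _ => trivial) hr
    exact ⟨fun x u α α₁ r hα hr => (key x u α α₁ r hα hr).1,
      fun x u α α₁ hα hr => (key x u α α₁ 0 hα hr).2 rfl⟩
  · have key := fun x u α α₁ r hα (hperp : α₁ u = 0) hr => MTW.crossCurvature_sign (x := x)
      (u := u) (α := α) (α₁ := α₁) (r := r) hV hε (hopen ε hε) (hdom ε hε hεε) (hreg ε hε)
      (R := fun u w => ⟪u, w⟫_ℝ = 0)
      (fun a b u w h => by simp [inner_smul_left, inner_smul_right, h])
      (fun y hy u w hu hw h =>
        (hcurv ε hε hεε y hy.2).2 u w hu hw (hpos _ _ hy.2 u w hu hw h))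
      hα (fun w hw => by rw [hw] at hperp; rwa [real_inner_comm]) hr
    exact ⟨fun x u α α₁ r hα hperp hr => (key x u α α₁ r hα hperp hr).1,
      fun x u α α₁ hα hperp hr => (key x u α α₁ 0 hα hperp hr).2 rfl⟩
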